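/- Let $\mathcal S$ be a quantum system of finite dimension $d\ge 1$ with Hamiltonian $H_S$, and let $0<\beta_H<\beta$. For a Hamiltonian $H$ write $\tau(b,H)=e^{-bH}/\mathrm{tr}\,e^{-bH}$, and let $F_\beta(\varrho)=\mathrm{tr}[H_S\varrho]-\beta^{-1}S(\varrho)$ with $S(\varrho)=-\mathrm{tr}[\varrho\log\varrho]$, and $\eta=1-\beta_H/\beta$. The target starts in $\tau(\beta,H_S)$. An incoherent control operation consists of finite-dimensional systems $\mathcal C$ (cold part) and $\mathcal H$ (hot part) with Hamiltonians $H_C,H_H$ and a unitary $U$ on $\mathcal S\mathcal C\mathcal H$ with $[U,H_S+H_C+H_H]=0$. It maps the target state $\varrho$ to $\mathrm{tr}_{CH}[\varrho']$, where $\varrho'=U(\varrho\otimes\tau(\beta,H_C)\otimes\tau(\beta_H,H_H))U^\dagger$, and draws the heat $\mathrm{tr}[H_H(\tau(\beta_H,H_H)-\varrho'_H)]$ from the hot bath, where $\varrho'_H=\mathrm{tr}_{SC}[\varrho']$; afterwards the machine is rethermalised. A protocol is a finite sequence of such operations; its heat is the sum of the heats drawn. The effective dimension of $U$ is the least dimension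 of a subspace $\mathcal A$ with $U=U_{\mathcal A}\oplus \mathbb 1_{\mathcal A^\perp}$. An operation has complexity at most $K$ if $\dim\mathcal C$, $\dim\mathcal H$ and the effective dimension of $U$ are all at most $K$. **Theorem.** There is a constant $K$ depending only on $d$ (more precisely, on the Hilbert space of $\mathcal S$), such that for all $H_S$ and all $0<\beta_H<\beta$ the following hold. (1) (Cooling to any temperature.) For every $\beta^*\ge\beta$ and all $\epsilon_1,\epsilon_2>0$ there is an $N_0$ such that for every $N\ge N_0$ there is a protocol of exactly $N$ operations of complexity at most $K$, whose final target state is $\tau(\beta',H_S)$ for some $\beta'$ with $|\beta'-\beta^*|<\epsilon_1$, and whose heat drawn from the hot bath, $Q$, satisfies $$\left|Q-\eta^{-1}\big(F_\beta(\tau(\beta^*,H_S))-F_\beta(\tau(\beta,H_S))\big)\right|<\epsilon_2 .$$ (2) (Perfect cooling at the Carnot–Landauer limit.) Let $\varrho_0=P_0/\mathrm{tr}P_0$, where $P_0$ is the projection onto the lowest energy level of $H_S$ (so $\varrho_0=|0\rangle\langle 0|$ if that level is nondegenerate). For all $\epsilon_1,\epsilon_2>0$ there is an $N_0$ such that for every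 $N\ge N_0$ there is a protocol of exactly $N$ operations of complexity at most $K$, whose final target state is at trace distance less than $\epsilon_1$ from $\varrho_0$, and whose heat $Q$ satisfies $$\left|Q-\eta^{-1}\big(F_\beta(\varrho_0)-F_\beta(\tau(\beta,H_S))\big)\right|<\epsilon_2 .$$ (3) (Unit time, diverging control complexity.) In (1) and (2), for every $N\ge N_0$ there is moreover a single incoherent control operation (on a larger machine) of effective dimension at least $N$ with the same final target state and the same heat drawn from the hot bath as the $N$-operation protocol. -/

import Mathlib

open scoped Matrix Kronecker

noncomputable section

section States

variable {n : Type*} [Fintype n] [DecidableEq n]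

/-- The thermal (Gibbs) state `τ(β, H) = e^{-βH} / tr e^{-βH}` of a finite-dimensional system. -/
def gibbsState (β : ℝ) (H : Matrix n n ℂ) : Matrix n n ℂ :=
  (NormedSpace.exp ((-(β : ℂ)) • H)).trace⁻¹ • NormedSpace.exp ((-(β : ℂ)) • H)

/-- The von Neumann entropy `S(ρ) = -tr (ρ log ρ)` (natural logarithm, with `0 log 0 = 0`). -/
def vonNeumannEntropy (ρ : Matrix n n ℂ) : ℝ :=
  -(ρ * cfc Real.log ρ).trace.re

/-- The mean energy `tr (H ρ)`. -/
def meanEnergy (H ρ : Matrix n n ℂ) : ℝ :=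
  (H * ρ).trace.re

/-- The free energy `F_β(ρ) = tr (H ρ) - β⁻¹ S(ρ)` of `ρ` with respect to a bath at inverse
temperature `β`. -/
def freeEnergy (β : ℝ) (H ρ : Matrix n n ℂ) : ℝ :=
  meanEnergy H ρ - β⁻¹ * vonNeumannEntropy ρ

/-- The orthogonal projection onto the eigenspace of the lowest energy of `H`. -/
def groundProjection (H : Matrix n n ℂ) : Matrix n n ℂ := by
  classical
  exact cfc (fun x : ℝ => if ∀ y ∈ spectrum ℝ H, x ≤ y then (1 : ℝ) else 0) H

/-- The ground state `P / tr P`, with `P` the projection onto the lowest energy level: the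
zero-temperature thermal state. It is the pure state `|0⟩⟨0|` when the lowest energy level is
nondegenerate. -/
def groundState (H : Matrix n n ℂ) : Matrix n n ℂ :=
  (groundProjection H).trace⁻¹ • groundProjection H

/-- The trace distance `½ tr √((ρ - σ)† (ρ - σ))`. -/
def traceDistance (ρ σ : Matrix n n ℂ) : ℝ :=
  (cfc Real.sqrt ((ρ - σ)ᴴ * (ρ - σ))).trace.re / 2

/-- The effective dimension of `U`: the minimal dimension of a subspace `A` such that
`U = U_A ⊕ 1` with respect to the decomposition `A ⊕ Aᗮ` of the Hilbert space. -/
def effectiveDimension (U : Matrix n n ℂ) : ℕ :=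
  sInf {k : ℕ | ∃ A : Submodule ℂ (EuclideanSpace ℂ n),
    Module.finrank ℂ A = k ∧
    (∀ x ∈ A, Matrix.toEuclideanLin U x ∈ A) ∧
    (∀ x ∈ Aᗮ, Matrix.toEuclideanLin U x = x)}

end States

section Tripartite

variable {s c h : Type*}

/-- The noninteracting Hamiltonian `H_S + H_C + H_H` of target, cold part and hot part. -/
def totalHamiltonian [DecidableEq s] [DecidableEq c] [DecidableEq h]
    (HS : Matrix s s ℂ) (HC : Matrix c c ℂ) (HH : Matrix h h ℂ) :
    Matrix (s × c × h) (s × c × h) ℂ :=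
  HS ⊗ₖ ((1 : Matrix c c ℂ) ⊗ₖ (1 : Matrix h h ℂ))
    + (1 : Matrix s s ℂ) ⊗ₖ (HC ⊗ₖ (1 : Matrix h h ℂ))
    + (1 : Matrix s s ℂ) ⊗ₖ ((1 : Matrix c c ℂ) ⊗ₖ HH)

/-- The reduced state of the target `S` (partial trace over the cold and the hot part). -/
def reducedTarget [Fintype c] [Fintype h] (ρ : Matrix (s × c × h) (s × c × h) ℂ) :
    Matrix s s ℂ :=
  Matrix.of fun i j => ∑ a, ∑ b, ρ (i, a, b) (j, a, b)

/-- The reduced state of the hot part (partial trace over the target and the cold part). -/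
def reducedHot [Fintype s] [Fintype c] (ρ : Matrix (s × c × h) (s × c × h) ℂ) :
    Matrix h h ℂ :=
  Matrix.of fun k l => ∑ i, ∑ a, ρ (i, a, k) (i, a, l)

end Tripartite

/-- One control operation of the incoherent paradigm on a target with Hamiltonian `HS`: a
finite-dimensional cold part `C` and hot part `Hot` of the machine with their Hamiltonians, and a
unitary on target, cold and hot part that conserves the total energy. -/
structure IncoherentOperation {s : Type*} [Fintype s] [DecidableEq s] (HS : Matrix s s ℂ) where
  C : Type
  Hot : Type
  [fintypeC : Fintype C]
  [fintypeHot : Fintype Hot]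
  [decEqC : DecidableEq C]
  [decEqHot : DecidableEq Hot]
  [nonemptyC : Nonempty C]
  [nonemptyHot : Nonempty Hot]
  HC : Matrix C C ℂ
  HH : Matrix Hot Hot ℂ
  isHermitian_HC : HC.IsHermitian
  isHermitian_HH : HH.IsHermitian
  U : Matrix (s × C × Hot) (s × C × Hot) ℂ
  unitary : U ∈ Matrix.unitaryGroup (s × C × Hot) ℂ
  energyConserving : U * totalHamiltonian HS HC HH = totalHamiltonian HS HC HH * U

attribute [instance] IncoherentOperation.fintypeC IncoherentOperation.fintypeHot
  IncoherentOperation.decEqC IncoherentOperation.decEqHot IncoherentOperation.nonemptyC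
  IncoherentOperation.nonemptyHot

section Protocols

variable {s : Type*} [Fintype s] [DecidableEq s] {HS : Matrix s s ℂ}

/-- The joint state `U (ρ ⊗ τ_C(β) ⊗ τ_H(β_H)) U†` after the operation, when the cold part starts
in equilibrium at inverse temperature `β` and the hot part at inverse temperature `βH`. -/
def IncoherentOperation.jointFinal (O : IncoherentOperation HS) (β βH : ℝ) (ρ : Matrix s s ℂ) :
    Matrix (s × O.C × O.Hot) (s × O.C × O.Hot) ℂ :=
  O.U * (ρ ⊗ₖ (gibbsState β O.HC ⊗ₖ gibbsState βH O.HH)) * O.Uᴴ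

/-- The state of the target after the operation. -/
def IncoherentOperation.output (O : IncoherentOperation HS) (β βH : ℝ) (ρ : Matrix s s ℂ) :
    Matrix s s ℂ :=
  reducedTarget (O.jointFinal β βH ρ)

/-- The heat drawn from the hot bath in the operation: the energy lost by the hot part, which the
hot bath returns in the rethermalisation that follows. -/
def IncoherentOperation.heat (O : IncoherentOperation HS) (β βH : ℝ) (ρ : Matrix s s ℂ) : ℝ :=
  meanEnergy O.HH (gibbsState βH O.HH) - meanEnergy O.HH (reducedHot (O.jointFinal β βH ρ))

/-- The final target state of a protocol, i.e. of a finite sequence of operations. The machine is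
rethermalised after each operation, so each operation meets thermal cold and hot parts that are
uncorrelated with the target. -/
def protocolOutput (β βH : ℝ) : List (IncoherentOperation HS) → Matrix s s ℂ → Matrix s s ℂ
  | [], ρ => ρ
  | O :: P, ρ => protocolOutput β βH P (O.output β βH ρ)

/-- The total heat drawn from the hot bath in a protocol. -/
def protocolHeat (β βH : ℝ) : List (IncoherentOperation HS) → Matrix s s ℂ → ℝ
  | [], _ => 0
  | O :: P, ρ => O.heat β βH ρ + protocolHeat β βH P (O.output β βH ρ)

/-- The operation has complexity at most `K`: the cold part, the hot part and the effective
dimension of the unitary are all of size at most `K`. -/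
def IncoherentOperation.ComplexityLE (O : IncoherentOperation HS) (K : ℕ) : Prop :=
  Fintype.card O.C ≤ K ∧ Fintype.card O.Hot ≤ K ∧ effectiveDimension O.U ≤ K

/-- A diverging number of operations of complexity at most `K`, or, equivalently, a single operation
of diverging complexity, takes the thermal target to a final state with property `final`, at a heat
cost with property `cost`: for every large enough `N` there is a protocol of exactly `N`
operations of complexity at most `K` that does so, and a single operation of effective
dimension at least `N` with the same final target state and the same heat drawn. -/
def AchievableWithin (HS : Matrix s s ℂ) (β βH : ℝ) (K : ℕ)
    (final : Matrix s s ℂ → Prop) (cost : ℝ → Prop) : Prop :=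
  ∃ N₀ : ℕ, ∀ N ≥ N₀,
    ∃ P : List (IncoherentOperation HS),
      P.length = N ∧ (∀ O ∈ P, O.ComplexityLE K) ∧
      final (protocolOutput β βH P (gibbsState β HS)) ∧
      cost (protocolHeat β βH P (gibbsState β HS)) ∧
      ∃ Q : IncoherentOperation HS,
        N ≤ effectiveDimension Q.U ∧
        Q.output β βH (gibbsState β HS) = protocolOutput β βH P (gibbsState β HS) ∧
        Q.heat β βH (gibbsState β HS) = protocolHeat β βH P (gibbsState β HS)

end Protocols

end

/-! In an eigenbasis of `HS` every target state that is needed is diagonal, so the task concerns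
level distributions and energy conserving permutations of joint levels. Let the target have d levels
ω_i. Give the hot part d levels h_i and the cold part levels ω_i - h_i: the joint machine levels
with equal indices have energies ω_i and form a virtual qudit that may be exchanged with the target.
Its populations are proportional to exp(-β ω_i + (β - βH) h_i), so a choice of h realises any
positive distribution σ. If the virtual qudit has total weight 1/T, the exchange sends p to p + (σ -
p)/T, and σ = p + T(p' - p) leads exactly to p'. Spare cold levels tune the weight to a prescribed T
(`exists_machine_outDist_eq`).

The heat of such a step is Σ h_i (p'_i - p_i) with (β - βH) h_i = log σ_i + β ω_i. To first order in
p' - p this is the increment of β F_β divided by β - βH, which is the Carnot-Landauer value; the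
error is quadratic (`abs_sum_hotLevel_sub_le`). Along thermal states with N equal steps of inverse
temperature, compactness gives a positive lower bound on all populations and one T for all steps, so
N errors of order 1/N² add up to O(1/N) (`exists_cooling_steps`). Only the energies of the machines
change with N; their dimensions depend on d alone. The ground state is the limit of Gibbs states and
the free energy converges along it, which reduces perfect cooling to a finite temperature.

For the single operation, all machines of the protocol are put side by side
(`PermutationMachine.comp`), with the same output and heat. Each factor has at least two idle
machine levels, so each further factor at least doubles the number of moved joint levels
(`card_support_comp`), and half that number is a lower bound on the effective dimension
(`card_support_le_two_mul_effectiveDimension`). -/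

noncomputable section

/-! ### Matrices diagonal in a fixed orthonormal basis, and reduction of the state functionals to
level distributions. -/

section UnitaryDiagonal

variable {n : Type*} [Fintype n] [DecidableEq n]

/-- The Hermitian matrix `V diag(x) V†`. -/
def unitaryDiagonal (V : Matrix n n ℂ) (x : n → ℝ) : Matrix n n ℂ :=
  V * Matrix.diagonal (fun i => (x i : ℂ)) * Vᴴ

variable {V : Matrix n n ℂ}

theorem conjTranspose_mul_self_of_mem_unitaryGroup (hV : V ∈ Matrix.unitaryGroup n ℂ) :
    Vᴴ * V = 1 := Matrix.mem_unitaryGroup_iff'.mp hV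

theorem mul_conjTranspose_self_of_mem_unitaryGroup (hV : V ∈ Matrix.unitaryGroup n ℂ) :
    V * Vᴴ = 1 := Matrix.mem_unitaryGroup_iff.mp hV

theorem unitaryDiagonal_apply (V : Matrix n n ℂ) (x : n → ℝ) (i j : n) :
    unitaryDiagonal V x i j = ∑ k, V i k * x k * star (V j k) := by
  rw [unitaryDiagonal, Matrix.mul_apply]
  simp only [Matrix.mul_diagonal, Matrix.conjTranspose_apply]

theorem trace_unitaryDiagonal (hV : V ∈ Matrix.unitaryGroup n ℂ) (x : n → ℝ) :
    (unitaryDiagonal V x).trace = ((∑ i, x i : ℝ) : ℂ) := by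
  rw [unitaryDiagonal, Matrix.trace_mul_comm, ← mul_assoc,
    conjTranspose_mul_self_of_mem_unitaryGroup hV]
  simp

theorem unitaryDiagonal_mul (hV : V ∈ Matrix.unitaryGroup n ℂ) (x y : n → ℝ) :
    unitaryDiagonal V x * unitaryDiagonal V y = unitaryDiagonal V (fun i => x i * y i) := by
  have h := conjTranspose_mul_self_of_mem_unitaryGroup hV
  calc unitaryDiagonal V x * unitaryDiagonal V y
      = V * Matrix.diagonal (fun i => (x i : ℂ)) * (Vᴴ * V) *
          Matrix.diagonal (fun i => (y i : ℂ)) * Vᴴ := by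
        simp only [unitaryDiagonal, mul_assoc]
    _ = _ := by
        rw [h, mul_one, mul_assoc V, Matrix.diagonal_mul_diagonal]
        simp [unitaryDiagonal]

theorem unitaryDiagonal_sub (x y : n → ℝ) :
    unitaryDiagonal V x - unitaryDiagonal V y = unitaryDiagonal V (fun i => x i - y i) := by
  simp only [unitaryDiagonal, ← sub_mul, ← mul_sub, Matrix.diagonal_sub]
  simp

theorem smul_unitaryDiagonal (a : ℝ) (x : n → ℝ) :
    (a : ℂ) • unitaryDiagonal V x = unitaryDiagonal V (fun i => a * x i) := by
  rw [unitaryDiagonal, unitaryDiagonal, ← Matrix.smul_mul, ← Matrix.mul_smul,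
    ← Matrix.diagonal_smul]
  congr 3
  ext i
  simp

theorem conjTranspose_unitaryDiagonal (x : n → ℝ) :
    (unitaryDiagonal V x)ᴴ = unitaryDiagonal V x := by
  simp only [unitaryDiagonal, Matrix.conjTranspose_mul, Matrix.conjTranspose_conjTranspose,
    Matrix.diagonal_conjTranspose, mul_assoc]
  congr 3
  ext i
  simp

/-- `x ↦ V diag(x) V†` as a homomorphism of real algebras. -/
def unitaryDiagonalAlgHom (hV : V ∈ Matrix.unitaryGroup n ℂ) : (n → ℝ) →ₐ[ℝ] Matrix n n ℂ :=
  AlgHom.ofLinearMap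
    { toFun := unitaryDiagonal V
      map_add' := fun x y => by
        simp only [unitaryDiagonal, ← add_mul, ← mul_add, Matrix.diagonal_add]
        simp
      map_smul' := fun a x => by
        have := smul_unitaryDiagonal (V := V) a x
        simp only [RingHom.id_apply]
        rw [Complex.coe_smul] at this
        rw [this]
        rfl }
    (by
      change unitaryDiagonal V 1 = 1
      simp [unitaryDiagonal, mul_conjTranspose_self_of_mem_unitaryGroup hV])
    (fun x y => (unitaryDiagonal_mul hV x y).symm)

theorem unitaryDiagonalAlgHom_apply (hV : V ∈ Matrix.unitaryGroup n ℂ) (x : n → ℝ) :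
    unitaryDiagonalAlgHom hV x = unitaryDiagonal V x := rfl

theorem spectrum_unitaryDiagonal_subset (hV : V ∈ Matrix.unitaryGroup n ℂ) (x : n → ℝ) :
    spectrum ℝ (unitaryDiagonal V x) ⊆ Set.range x := by
  rw [← unitaryDiagonalAlgHom_apply hV]
  refine (AlgHom.spectrum_apply_subset _ _).trans ?_
  rw [Pi.spectrum_eq]
  intro y hy
  simp only [Set.mem_iUnion] at hy
  obtain ⟨i, hi⟩ := hy
  by_contra hne
  refine hi ?_
  rw [spectrum.mem_resolventSet_iff, Algebra.algebraMap_self, RingHom.id_apply]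
  exact (sub_ne_zero.mpr fun h => hne ⟨i, h.symm⟩).isUnit

/-- The spectrum lies in the finite range of `x`, where `f` agrees with a Lagrange interpolation
polynomial, and polynomials commute with algebra homomorphisms. No continuity of `f` is needed,
which matters for the ground projection. -/
theorem cfc_unitaryDiagonal (hV : V ∈ Matrix.unitaryGroup n ℂ) (f : ℝ → ℝ) (x : n → ℝ) :
    cfc f (unitaryDiagonal V x) = unitaryDiagonal V (fun i => f (x i)) := by
  classical
  set q : Polynomial ℝ := Lagrange.interpolate (Finset.univ.image x) id f with hq
  have hqx : ∀ i, q.eval (x i) = f (x i) := fun i =>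
    Lagrange.eval_interpolate_at_node (v := id) f Function.injective_id.injOn
      (Finset.mem_image_of_mem x (Finset.mem_univ i))
  have hsa : IsSelfAdjoint (unitaryDiagonal V x) := conjTranspose_unitaryDiagonal x
  have h1 : cfc f (unitaryDiagonal V x) = cfc q.eval (unitaryDiagonal V x) := by
    refine cfc_congr fun y hy => ?_
    obtain ⟨i, rfl⟩ := spectrum_unitaryDiagonal_subset hV x hy
    exact (hqx i).symm
  rw [h1, cfc_polynomial q _ hsa, ← unitaryDiagonalAlgHom_apply hV, Polynomial.aeval_algHom_apply,
    unitaryDiagonalAlgHom_apply]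
  congr 1
  ext i
  rw [← hqx i, ← Polynomial.coe_aeval_eq_eval]
  exact (Polynomial.aeval_algHom_apply (Pi.evalAlgHom ℝ (fun _ : n => ℝ) i) x q).symm

theorem isHermitian_exists_eq_unitaryDiagonal {H : Matrix n n ℂ} (hH : H.IsHermitian) :
    ∃ V ∈ Matrix.unitaryGroup n ℂ, ∃ x : n → ℝ, H = unitaryDiagonal V x :=
  ⟨hH.eigenvectorUnitary, hH.eigenvectorUnitary.2, hH.eigenvalues, hH.spectral_theorem⟩

/-- The difference of `x i` and the matrix annihilates the projection onto the `i`-th basis vector,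
which is nonzero because its trace is 1. -/
theorem mem_spectrum_unitaryDiagonal (hV : V ∈ Matrix.unitaryGroup n ℂ) (x : n → ℝ) (i : n) :
    x i ∈ spectrum ℝ (unitaryDiagonal V x) := by
  intro h
  have h2 : unitaryDiagonal V (fun j => x i - x j) * unitaryDiagonal V (Pi.single i 1) = 0 := by
    rw [unitaryDiagonal_mul hV]
    have : (fun j => (x i - x j) * (Pi.single i 1 : n → ℝ) j) = 0 := by
      ext j
      by_cases hj : j = i
      · subst hj; simp
      · simp [hj]
    rw [this]
    exact map_zero (unitaryDiagonalAlgHom hV)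
  have h3 : algebraMap ℝ (Matrix n n ℂ) (x i) - unitaryDiagonal V x
      = unitaryDiagonal V (fun j => x i - x j) := by
    rw [← unitaryDiagonalAlgHom_apply hV, ← AlgHom.commutes (unitaryDiagonalAlgHom hV), ← map_sub]
    rfl
  rw [spectrum.mem_resolventSet_iff, h3] at h
  have h4 := (h.mul_right_eq_zero).mp h2
  have h5 := trace_unitaryDiagonal hV (Pi.single i 1 : n → ℝ)
  rw [h4] at h5
  simp at h5

/-- The Boltzmann distribution of inverse temperature `b` for the energies `x`. -/
def boltzmann (b : ℝ) (x : n → ℝ) (i : n) : ℝ :=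
  Real.exp (-b * x i) / ∑ j, Real.exp (-b * x j)

theorem gibbsState_unitaryDiagonal (hV : V ∈ Matrix.unitaryGroup n ℂ) (b : ℝ) (x : n → ℝ) :
    gibbsState b (unitaryDiagonal V x) = unitaryDiagonal V (boltzmann b x) := by
  have hinv : V⁻¹ = Vᴴ := Matrix.inv_eq_left_inv (conjTranspose_mul_self_of_mem_unitaryGroup hV)
  have hexp : NormedSpace.exp ((-(b : ℂ)) • unitaryDiagonal V x)
      = unitaryDiagonal V (fun i => Real.exp (-b * x i)) := by
    rw [← Complex.ofReal_neg, smul_unitaryDiagonal, unitaryDiagonal, ← hinv, Matrix.exp_conj,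
      Matrix.exp_diagonal, hinv, unitaryDiagonal]
    · congr 3
      ext i
      rw [Pi.coe_exp, Complex.ofReal_exp, ← Complex.exp_eq_exp_ℂ]
    · exact ⟨⟨V, Vᴴ, mul_conjTranspose_self_of_mem_unitaryGroup hV,
        conjTranspose_mul_self_of_mem_unitaryGroup hV⟩, rfl⟩
  rw [gibbsState, hexp, trace_unitaryDiagonal hV, ← Complex.ofReal_inv, smul_unitaryDiagonal]
  congr 1
  ext i
  rw [boltzmann, div_eq_inv_mul]

theorem meanEnergy_unitaryDiagonal (hV : V ∈ Matrix.unitaryGroup n ℂ) (x p : n → ℝ) :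
    meanEnergy (unitaryDiagonal V x) (unitaryDiagonal V p) = ∑ i, x i * p i := by
  rw [meanEnergy, unitaryDiagonal_mul hV, trace_unitaryDiagonal hV, Complex.ofReal_re]

theorem freeEnergy_unitaryDiagonal (hV : V ∈ Matrix.unitaryGroup n ℂ) (b : ℝ) (x p : n → ℝ) :
    freeEnergy b (unitaryDiagonal V x) (unitaryDiagonal V p)
      = ∑ i, x i * p i - b⁻¹ * ∑ i, Real.negMulLog (p i) := by
  rw [freeEnergy, meanEnergy_unitaryDiagonal hV, vonNeumannEntropy, cfc_unitaryDiagonal hV,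
    unitaryDiagonal_mul hV, trace_unitaryDiagonal hV, Complex.ofReal_re, ← Finset.sum_neg_distrib]
  simp only [Real.negMulLog, neg_mul]

theorem traceDistance_unitaryDiagonal (hV : V ∈ Matrix.unitaryGroup n ℂ) (p q : n → ℝ) :
    traceDistance (unitaryDiagonal V p) (unitaryDiagonal V q) = (∑ i, |p i - q i|) / 2 := by
  rw [traceDistance, unitaryDiagonal_sub, conjTranspose_unitaryDiagonal, unitaryDiagonal_mul hV,
    cfc_unitaryDiagonal hV, trace_unitaryDiagonal hV, Complex.ofReal_re]
  simp only [Real.sqrt_mul_self_eq_abs]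

open Classical in
/-- The uniform distribution on the set of minimizers of `x`. -/
def minimizerDist (x : n → ℝ) (i : n) : ℝ :=
  (if ∀ j, x i ≤ x j then 1 else 0) / ∑ k, (if ∀ j, x k ≤ x j then 1 else 0)

theorem groundState_unitaryDiagonal (hV : V ∈ Matrix.unitaryGroup n ℂ) (x : n → ℝ) :
    groundState (unitaryDiagonal V x) = unitaryDiagonal V (minimizerDist x) := by
  classical
  have hspec : spectrum ℝ (unitaryDiagonal V x) = Set.range x :=
    (spectrum_unitaryDiagonal_subset hV x).antisymm
      (Set.range_subset_iff.mpr (mem_spectrum_unitaryDiagonal hV x))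
  have hproj : groundProjection (unitaryDiagonal V x)
      = unitaryDiagonal V (fun i => if ∀ j, x i ≤ x j then 1 else 0) := by
    rw [groundProjection, cfc_unitaryDiagonal hV]
    congr 1
    ext i
    simp only [hspec, Set.forall_mem_range]
  rw [groundState, hproj, trace_unitaryDiagonal hV, ← Complex.ofReal_inv, smul_unitaryDiagonal]
  congr 1
  ext i
  rw [minimizerDist, div_eq_inv_mul]

end UnitaryDiagonal

/-! ### Bounds on the effective dimension. -/

section EffectiveDimension

variable {n : Type*} [Fintype n] [DecidableEq n]

theorem exists_finrank_eq_effectiveDimension (U : Matrix n n ℂ) :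
    ∃ A : Submodule ℂ (EuclideanSpace ℂ n), Module.finrank ℂ A = effectiveDimension U ∧
      (∀ x ∈ A, Matrix.toEuclideanLin U x ∈ A) ∧ (∀ x ∈ Aᗮ, Matrix.toEuclideanLin U x = x) := by
  refine Nat.sInf_mem (s := {k : ℕ | ∃ A : Submodule ℂ (EuclideanSpace ℂ n),
    Module.finrank ℂ A = k ∧ (∀ x ∈ A, Matrix.toEuclideanLin U x ∈ A) ∧
    (∀ x ∈ Aᗮ, Matrix.toEuclideanLin U x = x)}) ⟨_, ⊤, rfl, fun _ _ => trivial, fun x hx => ?_⟩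
  rw [Submodule.top_orthogonal_eq_bot, Submodule.mem_bot] at hx
  rw [hx, map_zero]

theorem effectiveDimension_le_card (U : Matrix n n ℂ) :
    effectiveDimension U ≤ Fintype.card n := by
  obtain ⟨A, hA, -⟩ := exists_finrank_eq_effectiveDimension U
  rw [← hA, ← finrank_euclideanSpace (𝕜 := ℂ) (ι := n)]
  exact A.finrank_le

theorem norm_toEuclideanLin_of_mem_unitaryGroup {U : Matrix n n ℂ}
    (hU : U ∈ Matrix.unitaryGroup n ℂ) (x : EuclideanSpace ℂ n) :
    ‖Matrix.toEuclideanLin U x‖ = ‖x‖ := by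
  have h : inner ℂ (Matrix.toEuclideanLin U x) (Matrix.toEuclideanLin U x) = inner ℂ x x := by
    rw [← LinearMap.adjoint_inner_right, ← Matrix.toEuclideanLin_conjTranspose_eq_adjoint]
    congr 1
    simp [Matrix.toLpLin_apply, conjTranspose_mul_self_of_mem_unitaryGroup hU]
  rw [@norm_eq_sqrt_re_inner ℂ, @norm_eq_sqrt_re_inner ℂ, h]

/-- The real part of `tr (1 - U)` is at most twice the effective dimension of a unitary `U`. -/
theorem re_trace_one_sub_le_two_mul_effectiveDimension {U : Matrix n n ℂ}
    (hU : U ∈ Matrix.unitaryGroup n ℂ) :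
    ((1 - U).trace).re ≤ 2 * effectiveDimension U := by
  obtain ⟨A, hA, -, hperp⟩ := exists_finrank_eq_effectiveDimension U
  set T : EuclideanSpace ℂ n →ₗ[ℂ] EuclideanSpace ℂ n := Matrix.toEuclideanLin (1 - U) with hT
  have hTx : ∀ x, T x = x - Matrix.toEuclideanLin U x := fun x => by
    rw [hT, map_sub, LinearMap.sub_apply]
    congr 1
    simp
  have htr : (1 - U).trace = LinearMap.trace ℂ _ T := by
    exact (Matrix.trace_toLin_eq (1 - U) (PiLp.basisFun 2 ℂ n)).symm
  -- `1 - U` vanishes on the orthogonal complement of `A`, so it factors through the projection onto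
  -- `A`. Cyclicity then turns the trace into one over `A`, where each diagonal entry has norm at
  -- most 2.
  have hfac : T = (T ∘ₗ A.subtype) ∘ₗ (A.orthogonalProjectionOnto : _ →ₗ[ℂ] A) := by
    ext1 x
    have h0 : T (x - A.orthogonalProjectionOnto x) = 0 := by
      rw [hTx, sub_eq_zero]
      exact (hperp _ (Submodule.sub_starProjection_mem_orthogonal x)).symm
    rw [map_sub, sub_eq_zero] at h0
    exact h0
  rw [htr, hfac, LinearMap.trace_comp_comm',
    LinearMap.trace_eq_sum_inner _ (stdOrthonormalBasis ℂ A), ← hA]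
  refine (Complex.re_le_norm _).trans ((norm_sum_le _ _).trans ?_)
  refine (Finset.sum_le_sum (g := fun _ => (2 : ℝ)) fun i _ => ?_).trans ?_
  · set b := stdOrthonormalBasis ℂ A i with hb
    have hb1 : ‖b‖ = 1 := (stdOrthonormalBasis ℂ A).orthonormal.1 i
    have hb2 : ‖(b : EuclideanSpace ℂ n)‖ = 1 := hb1
    refine (norm_inner_le_norm _ _).trans ?_
    rw [hb1, one_mul]
    have h1 : ‖A.orthogonalProjectionOnto (T b)‖ ≤ ‖T b‖ :=
      A.norm_orthogonalProjectionOnto_apply_le _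
    refine h1.trans ?_
    rw [hTx]
    refine (norm_sub_le _ _).trans ?_
    rw [norm_toEuclideanLin_of_mem_unitaryGroup hU, hb2]
    norm_num
  · simp [mul_comm]

end EffectiveDimension

/-! ### Unitaries that permute an orthonormal basis. -/

section PermutationUnitary

variable {n : Type*} [Fintype n] [DecidableEq n]

/-- The unitary that permutes the columns of `W` by `π`. -/
def permutationUnitary (W : Matrix n n ℂ) (π : Equiv.Perm n) : Matrix n n ℂ :=
  W * (1 : Matrix n n ℂ).submatrix id π * Wᴴ

variable {W : Matrix n n ℂ}

theorem permutationUnitary_mul_unitaryDiagonal_mul (hW : W ∈ Matrix.unitaryGroup n ℂ)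
    (π : Equiv.Perm n) (f : n → ℝ) :
    permutationUnitary W π * unitaryDiagonal W f * (permutationUnitary W π)ᴴ
      = unitaryDiagonal W (fun x => f (π.symm x)) := by
  have h := conjTranspose_mul_self_of_mem_unitaryGroup hW
  have hP : (1 : Matrix n n ℂ).submatrix id π * Matrix.diagonal (fun i => (f i : ℂ))
      * ((1 : Matrix n n ℂ).submatrix id π)ᴴ
      = Matrix.diagonal (fun i => (f (π.symm i) : ℂ)) := by
    ext i j
    rw [Matrix.mul_apply, ← Equiv.sum_comp π.symm]
    simp [Matrix.one_apply, Matrix.diagonal_apply]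
    aesop
  rw [unitaryDiagonal, unitaryDiagonal, ← hP, permutationUnitary]
  simp only [Matrix.conjTranspose_mul, Matrix.conjTranspose_conjTranspose, mul_assoc]
  rw [← mul_assoc Wᴴ W, h, one_mul, ← mul_assoc Wᴴ W, h, one_mul]

theorem permutationUnitary_mem_unitaryGroup (hW : W ∈ Matrix.unitaryGroup n ℂ)
    (π : Equiv.Perm n) : permutationUnitary W π ∈ Matrix.unitaryGroup n ℂ := by
  have h := permutationUnitary_mul_unitaryDiagonal_mul hW π (fun _ => 1)
  have h1 : unitaryDiagonal W (fun _ => 1) = 1 := map_one (unitaryDiagonalAlgHom hW)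
  rw [h1, mul_one] at h
  exact Matrix.mem_unitaryGroup_iff.mpr h

theorem permutationUnitary_mul_comm (hW : W ∈ Matrix.unitaryGroup n ℂ) (π : Equiv.Perm n)
    (f : n → ℝ) (hf : ∀ x, f (π x) = f x) :
    permutationUnitary W π * unitaryDiagonal W f
      = unitaryDiagonal W f * permutationUnitary W π := by
  have h := permutationUnitary_mul_unitaryDiagonal_mul hW π f
  have h1 : (fun x => f (π.symm x)) = f := by
    ext x
    rw [← hf (π.symm x), Equiv.apply_symm_apply]
  rw [h1] at h
  nth_rewrite 2 [← h]
  rw [mul_assoc _ _ (permutationUnitary W π), conjTranspose_mul_self_of_mem_unitaryGroup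
    (permutationUnitary_mem_unitaryGroup hW π), mul_one]

/-- The trace of `1 - U` counts the points that `π` moves. -/
theorem card_support_le_two_mul_effectiveDimension (hW : W ∈ Matrix.unitaryGroup n ℂ)
    (π : Equiv.Perm n) :
    π.support.card ≤ 2 * effectiveDimension (permutationUnitary W π) := by
  have h := re_trace_one_sub_le_two_mul_effectiveDimension
    (permutationUnitary_mem_unitaryGroup hW π)
  have htr : (1 - permutationUnitary W π).trace = (π.support.card : ℂ) := by
    rw [Matrix.trace_sub, permutationUnitary, Matrix.trace_mul_comm, ← mul_assoc,
      conjTranspose_mul_self_of_mem_unitaryGroup hW, one_mul, ← Matrix.trace_sub, Matrix.trace,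
      Finset.card_eq_sum_ones, Nat.cast_sum, ← Finset.sum_filter_add_sum_filter_not
      Finset.univ (fun x => π x ≠ x)]
    have hs : π.support = Finset.univ.filter (fun x => π x ≠ x) := by
      ext x; simp
    rw [hs, Finset.sum_eq_zero (s := Finset.univ.filter (fun x => ¬ π x ≠ x)), add_zero]
    · refine Finset.sum_congr rfl fun x hx => ?_
      have hx2 : x ≠ π x := (Finset.mem_filter.mp hx).2.symm
      simp [hx2]
    · intro x hx
      have hx2 : π x = x := by simpa using hx
      simp [Matrix.one_apply, hx2]
  rw [htr] at h
  exact_mod_cast h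

end PermutationUnitary

/-! ### Tensor products of diagonal matrices. -/

section Kronecker

variable {m n : Type*} [Fintype m] [DecidableEq m] [Fintype n] [DecidableEq n]

theorem unitaryDiagonal_kronecker (V : Matrix m m ℂ) (V' : Matrix n n ℂ) (x : m → ℝ)
    (y : n → ℝ) :
    unitaryDiagonal V x ⊗ₖ unitaryDiagonal V' y
      = unitaryDiagonal (V ⊗ₖ V') (fun z => x z.1 * y z.2) := by
  simp only [unitaryDiagonal, Matrix.mul_kronecker_mul, Matrix.diagonal_kronecker_diagonal,
    Matrix.conjTranspose_kronecker, Complex.ofReal_mul]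

theorem unitaryDiagonal_const_one {V : Matrix n n ℂ} (hV : V ∈ Matrix.unitaryGroup n ℂ) :
    unitaryDiagonal V (fun _ => 1) = 1 := map_one (unitaryDiagonalAlgHom hV)

theorem unitaryDiagonal_add (V : Matrix n n ℂ) (x y : n → ℝ) :
    unitaryDiagonal V x + unitaryDiagonal V y = unitaryDiagonal V (fun i => x i + y i) := by
  simp only [unitaryDiagonal, ← add_mul, ← mul_add, Matrix.diagonal_add]
  simp

theorem kronecker_one_mem_unitaryGroup {V : Matrix m m ℂ} (hV : V ∈ Matrix.unitaryGroup m ℂ) :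
    V ⊗ₖ (1 : Matrix n n ℂ) ∈ Matrix.unitaryGroup (m × n) ℂ :=
  Matrix.kronecker_mem_unitary hV (one_mem _)

end Kronecker

/-! ### Partial traces as marginals. -/

section PartialTraces

variable {s c h : Type*} [Fintype s] [DecidableEq s] [Fintype c] [DecidableEq c]
  [Fintype h] [DecidableEq h] {V : Matrix s s ℂ}

theorem unitaryDiagonal_kronecker_one_apply (V : Matrix s s ℂ) (f : s × c × h → ℝ)
    (i j : s) (a a' : c) (b b' : h) :
    unitaryDiagonal (V ⊗ₖ (1 : Matrix (c × h) (c × h) ℂ)) f (i, a, b) (j, a', b')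
      = if a = a' ∧ b = b' then unitaryDiagonal V (fun k => f (k, a, b)) i j else 0 := by
  simp only [unitaryDiagonal_apply, Fintype.sum_prod_type, Matrix.kroneckerMap_apply,
    Matrix.one_apply, Prod.mk.injEq]
  split_ifs with hab
  · obtain ⟨rfl, rfl⟩ := hab
    refine Finset.sum_congr rfl fun k _ => ?_
    rw [Finset.sum_eq_single a, Finset.sum_eq_single b]
    · simp
    · intro x _ hx
      simp [hx.symm]
    · simp
    · intro x _ hx
      simp [hx.symm]
    · simp
  · refine Finset.sum_eq_zero fun k _ => Finset.sum_eq_zero fun x _ =>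
      Finset.sum_eq_zero fun y _ => ?_
    by_cases h1 : a = x ∧ b = y
    · obtain ⟨rfl, rfl⟩ := h1
      have : ¬ (a' = a ∧ b' = b) := fun h2 => hab ⟨h2.1.symm, h2.2.symm⟩
      simp [this]
    · simp [h1]

theorem reducedTarget_unitaryDiagonal (V : Matrix s s ℂ) (f : s × c × h → ℝ) :
    reducedTarget (unitaryDiagonal (V ⊗ₖ (1 : Matrix (c × h) (c × h) ℂ)) f)
      = unitaryDiagonal V (fun i => ∑ a, ∑ b, f (i, a, b)) := by
  ext i j
  simp only [reducedTarget, Matrix.of_apply, unitaryDiagonal_kronecker_one_apply, and_self,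
    if_true]
  simp only [unitaryDiagonal_apply, Complex.ofReal_sum, Finset.mul_sum, Finset.sum_mul]
  simp_rw [Finset.sum_comm (s := (Finset.univ : Finset h)) (t := (Finset.univ : Finset s))]
  rw [Finset.sum_comm]

theorem reducedHot_unitaryDiagonal (hV : V ∈ Matrix.unitaryGroup s ℂ) (f : s × c × h → ℝ) :
    reducedHot (unitaryDiagonal (V ⊗ₖ (1 : Matrix (c × h) (c × h) ℂ)) f)
      = unitaryDiagonal 1 (fun b => ∑ i, ∑ a, f (i, a, b)) := by
  ext k l
  simp only [reducedHot, Matrix.of_apply, unitaryDiagonal_kronecker_one_apply, true_and]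
  have h1 : ∀ g : h → ℝ, unitaryDiagonal 1 g k l = if k = l then (g k : ℂ) else 0 := fun g => by
    simp +contextual [unitaryDiagonal, Matrix.one_apply]
  rw [h1]
  split_ifs with hkl
  · rw [Finset.sum_comm, Finset.sum_comm (f := fun i a => f (i, a, k)), Complex.ofReal_sum]
    refine Finset.sum_congr rfl fun a _ => ?_
    rw [← trace_unitaryDiagonal hV]
    rfl
  · simp

end PartialTraces

theorem totalHamiltonian_unitaryDiagonal {s c h : Type*} [Fintype s] [DecidableEq s]
    [Fintype c] [DecidableEq c] [Fintype h] [DecidableEq h] {V : Matrix s s ℂ}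
    (hV : V ∈ Matrix.unitaryGroup s ℂ) (x : s → ℝ) (y : c → ℝ) (z : h → ℝ) :
    totalHamiltonian (unitaryDiagonal V x) (unitaryDiagonal 1 y) (unitaryDiagonal 1 z)
      = unitaryDiagonal (V ⊗ₖ (1 : Matrix (c × h) (c × h) ℂ))
          (fun w => x w.1 + y w.2.1 + z w.2.2) := by
  rw [totalHamiltonian, ← unitaryDiagonal_const_one hV,
    ← unitaryDiagonal_const_one (one_mem (Matrix.unitaryGroup c ℂ)),
    ← unitaryDiagonal_const_one (one_mem (Matrix.unitaryGroup h ℂ))]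
  simp only [unitaryDiagonal_kronecker]
  simp only [unitaryDiagonal_const_one (one_mem (Matrix.unitaryGroup _ ℂ)), unitaryDiagonal_add, Matrix.one_kronecker_one, mul_one, one_mul]

theorem boltzmann_pos {n : Type*} [Fintype n] (b : ℝ) (x : n → ℝ) (i : n) :
    0 < boltzmann b x i :=
  div_pos (Real.exp_pos _) (Finset.sum_pos (fun _ _ => Real.exp_pos _) ⟨i, Finset.mem_univ i⟩)

theorem sum_boltzmann {n : Type*} [Fintype n] [Nonempty n] (b : ℝ) (x : n → ℝ) :
    ∑ i, boltzmann b x i = 1 := by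
  simp only [boltzmann, ← Finset.sum_div]
  exact div_self (Finset.sum_pos (fun _ _ => Real.exp_pos _) Finset.univ_nonempty).ne'

theorem boltzmann_prod {m n : Type*} [Fintype m] [Fintype n] (b : ℝ) (x : m → ℝ) (y : n → ℝ)
    (i : m) (j : n) :
    boltzmann b (fun z : m × n => x z.1 + y z.2) (i, j) = boltzmann b x i * boltzmann b y j := by
  simp only [boltzmann, Fintype.sum_prod_type, mul_add, Real.exp_add, div_mul_div_comm,
    Finset.sum_mul_sum]

/-! ### Permutation machines, their composition and the operations they induce. -/

/-- A cold part and a hot part with prescribed energy levels, together with an energy conserving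
permutation of the joint energy levels of target, cold part and hot part. -/
structure PermutationMachine {s : Type*} (ω : s → ℝ) where
  C : Type
  Hot : Type
  [fintypeC : Fintype C]
  [fintypeHot : Fintype Hot]
  [decEqC : DecidableEq C]
  [decEqHot : DecidableEq Hot]
  [nonemptyC : Nonempty C]
  [nonemptyHot : Nonempty Hot]
  coldEnergy : C → ℝ
  hotEnergy : Hot → ℝ
  perm : Equiv.Perm (s × C × Hot)
  energy_perm : ∀ x, ω (perm x).1 + coldEnergy (perm x).2.1 + hotEnergy (perm x).2.2
    = ω x.1 + coldEnergy x.2.1 + hotEnergy x.2.2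

attribute [instance] PermutationMachine.fintypeC PermutationMachine.fintypeHot
  PermutationMachine.decEqC PermutationMachine.decEqHot PermutationMachine.nonemptyC
  PermutationMachine.nonemptyHot

namespace PermutationMachine

section

variable {s : Type*} [Fintype s] {ω : s → ℝ}

/-- The joint level distribution of target, cold part and hot part before the operation. -/
def joint (O : PermutationMachine ω) (β βH : ℝ) (p : s → ℝ) (x : s × O.C × O.Hot) : ℝ :=
  p x.1 * (boltzmann β O.coldEnergy x.2.1 * boltzmann βH O.hotEnergy x.2.2)

/-- The level distribution of the target after the operation. -/
def outDist (O : PermutationMachine ω) (β βH : ℝ) (p : s → ℝ) (i : s) : ℝ :=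
  ∑ a, ∑ b, O.joint β βH p (O.perm.symm (i, a, b))

/-- The heat drawn from the hot bath in terms of level distributions. -/
def classicalHeat (O : PermutationMachine ω) (β βH : ℝ) (p : s → ℝ) : ℝ :=
  ∑ x, O.joint β βH p x * (O.hotEnergy x.2.2 - O.hotEnergy (O.perm x).2.2)

theorem sum_joint_eq_one (O : PermutationMachine ω) (β βH : ℝ) {p : s → ℝ}
    (hp : ∑ i, p i = 1) : ∑ x, O.joint β βH p x = 1 := by
  simp only [joint, Fintype.sum_prod_type, ← Finset.mul_sum, sum_boltzmann, mul_one, hp]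

theorem sum_joint_mul (O : PermutationMachine ω) (β βH : ℝ) {p : s → ℝ} (f : s → ℝ) :
    ∑ x, O.joint β βH p x * f (O.perm x).1 = ∑ i, O.outDist β βH p i * f i := by
  rw [← Equiv.sum_comp O.perm.symm]
  simp only [Equiv.apply_symm_apply, Fintype.sum_prod_type, outDist, Finset.sum_mul]

/-- The machine that runs `O` and then `Q` on independent cold and hot parts. -/
abbrev comp (O Q : PermutationMachine ω) : PermutationMachine ω where
  C := O.C × Q.C
  Hot := O.Hot × Q.Hot
  coldEnergy := fun a => O.coldEnergy a.1 + Q.coldEnergy a.2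
  hotEnergy := fun b => O.hotEnergy b.1 + Q.hotEnergy b.2
  perm :=
    { toFun := fun x =>
        let y := O.perm (x.1, x.2.1.1, x.2.2.1)
        let z := Q.perm (y.1, x.2.1.2, x.2.2.2)
        (z.1, (y.2.1, z.2.1), (y.2.2, z.2.2))
      invFun := fun x =>
        let z := Q.perm.symm (x.1, x.2.1.2, x.2.2.2)
        let y := O.perm.symm (z.1, x.2.1.1, x.2.2.1)
        (y.1, (y.2.1, z.2.1), (y.2.2, z.2.2))
      left_inv := fun x => by simp
      right_inv := fun x => by simp }
  energy_perm := fun x => by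
    have h1 := O.energy_perm (x.1, x.2.1.1, x.2.2.1)
    have h2 := Q.energy_perm ((O.perm (x.1, x.2.1.1, x.2.2.1)).1, x.2.1.2, x.2.2.2)
    simp only [Equiv.coe_fn_mk] at h1 h2 ⊢
    linarith

/-- Energies of the composite add, so Boltzmann weights factor and the machine levels of `Q` are
independent of everything `O` touches. The general `f` serves both the heat and the output. -/
theorem sum_joint_comp (O Q : PermutationMachine ω) (β βH : ℝ) (p : s → ℝ)
    (f : s × O.C × O.Hot → Q.C → Q.Hot → ℝ) :
    ∑ x : s × (O.C × Q.C) × O.Hot × Q.Hot,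
        (O.comp Q).joint β βH p x * f (x.1, x.2.1.1, x.2.2.1) x.2.1.2 x.2.2.2
      = ∑ x, O.joint β βH p x * ∑ a, ∑ b,
          boltzmann β Q.coldEnergy a * boltzmann βH Q.hotEnergy b * f x a b := by
  have hj : ∀ i a a' b b', (O.comp Q).joint β βH p (i, (a, a'), (b, b'))
      = O.joint β βH p (i, a, b) *
        (boltzmann β Q.coldEnergy a' * boltzmann βH Q.hotEnergy b') := by
    intro i a a' b b'
    have h1 : boltzmann β (O.comp Q).coldEnergy (a, a') = _ :=
      boltzmann_prod β O.coldEnergy Q.coldEnergy a a'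
    have h2 : boltzmann βH (O.comp Q).hotEnergy (b, b') = _ :=
      boltzmann_prod βH O.hotEnergy Q.hotEnergy b b'
    simp only [joint]
    rw [h1, h2]
    ring
  simp only [Fintype.sum_prod_type]
  refine Finset.sum_congr rfl fun i _ => Finset.sum_congr rfl fun a _ => ?_
  rw [Finset.sum_comm]
  refine Finset.sum_congr rfl fun b _ => ?_
  rw [Finset.mul_sum]
  refine Finset.sum_congr rfl fun a' _ => ?_
  rw [Finset.mul_sum]
  refine Finset.sum_congr rfl fun b' _ => ?_
  rw [hj]
  ring

/-- The first machine enters only through the target distribution it leaves behind: correlations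
with its used parts are invisible to `Q`. -/
theorem sum_joint_mul_sum (O Q : PermutationMachine ω) (β βH : ℝ) (p : s → ℝ)
    (g : s × Q.C × Q.Hot → ℝ) :
    ∑ x, O.joint β βH p x * ∑ a, ∑ b,
        boltzmann β Q.coldEnergy a * boltzmann βH Q.hotEnergy b * g ((O.perm x).1, a, b)
      = ∑ y, Q.joint β βH (O.outDist β βH p) y * g y := by
  rw [O.sum_joint_mul β βH (fun i => ∑ a, ∑ b,
    boltzmann β Q.coldEnergy a * boltzmann βH Q.hotEnergy b * g (i, a, b))]
  simp only [Fintype.sum_prod_type, Finset.mul_sum, joint, mul_assoc]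

theorem classicalHeat_comp (O Q : PermutationMachine ω) (β βH : ℝ) (p : s → ℝ) :
    (O.comp Q).classicalHeat β βH p
      = O.classicalHeat β βH p + Q.classicalHeat β βH (O.outDist β βH p) := by
  have h1 := sum_joint_comp O Q β βH p
    (fun x _ _ => O.hotEnergy x.2.2 - O.hotEnergy (O.perm x).2.2)
  have h2 := (sum_joint_comp O Q β βH p (fun x a b => Q.hotEnergy b -
    Q.hotEnergy (Q.perm ((O.perm x).1, a, b)).2.2)).trans (sum_joint_mul_sum O Q β βH p
      fun y => Q.hotEnergy y.2.2 - Q.hotEnergy (Q.perm y).2.2)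
  simp only [← Finset.sum_mul, ← Finset.mul_sum, sum_boltzmann, mul_one, one_mul] at h1
  rw [classicalHeat, classicalHeat, classicalHeat, ← h1, ← h2]
  refine (Finset.sum_congr rfl fun x _ => ?_).trans Finset.sum_add_distrib
  simp only [comp, Equiv.coe_fn_mk]
  ring

end

variable {s : Type*} [Fintype s] [DecidableEq s] {ω : s → ℝ} {V : Matrix s s ℂ}

/-- The control operation on a target with Hamiltonian `V diag(ω) V†` that a permutation machine
induces. -/
abbrev toIncoherentOperation (O : PermutationMachine ω) (hV : V ∈ Matrix.unitaryGroup s ℂ) :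
    IncoherentOperation (unitaryDiagonal V ω) where
  C := O.C
  Hot := O.Hot
  HC := unitaryDiagonal 1 O.coldEnergy
  HH := unitaryDiagonal 1 O.hotEnergy
  isHermitian_HC := conjTranspose_unitaryDiagonal _
  isHermitian_HH := conjTranspose_unitaryDiagonal _
  U := permutationUnitary (V ⊗ₖ 1) O.perm
  unitary := permutationUnitary_mem_unitaryGroup (kronecker_one_mem_unitaryGroup hV) _
  energyConserving := by
    rw [totalHamiltonian_unitaryDiagonal hV]
    exact permutationUnitary_mul_comm (kronecker_one_mem_unitaryGroup hV) _ _ O.energy_perm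

theorem jointFinal_toIncoherentOperation (O : PermutationMachine ω)
    (hV : V ∈ Matrix.unitaryGroup s ℂ) (β βH : ℝ) (p : s → ℝ) :
    (O.toIncoherentOperation hV).jointFinal β βH (unitaryDiagonal V p)
      = unitaryDiagonal (V ⊗ₖ (1 : Matrix (O.C × O.Hot) (O.C × O.Hot) ℂ))
          (fun x => O.joint β βH p (O.perm.symm x)) := by
  simp only [IncoherentOperation.jointFinal, toIncoherentOperation]
  rw [gibbsState_unitaryDiagonal (one_mem _), gibbsState_unitaryDiagonal (one_mem _),
    unitaryDiagonal_kronecker, unitaryDiagonal_kronecker, Matrix.one_kronecker_one,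
    permutationUnitary_mul_unitaryDiagonal_mul (kronecker_one_mem_unitaryGroup hV)]
  rfl

theorem output_toIncoherentOperation (O : PermutationMachine ω)
    (hV : V ∈ Matrix.unitaryGroup s ℂ) (β βH : ℝ) (p : s → ℝ) :
    (O.toIncoherentOperation hV).output β βH (unitaryDiagonal V p)
      = unitaryDiagonal V (O.outDist β βH p) := by
  rw [IncoherentOperation.output, jointFinal_toIncoherentOperation]
  exact reducedTarget_unitaryDiagonal V _

theorem heat_toIncoherentOperation (O : PermutationMachine ω)
    (hV : V ∈ Matrix.unitaryGroup s ℂ) (β βH : ℝ) {p : s → ℝ} (hp : ∑ i, p i = 1) :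
    (O.toIncoherentOperation hV).heat β βH (unitaryDiagonal V p) = O.classicalHeat β βH p := by
  rw [IncoherentOperation.heat, jointFinal_toIncoherentOperation]
  have h1 : reducedHot (unitaryDiagonal (V ⊗ₖ (1 : Matrix (O.C × O.Hot) (O.C × O.Hot) ℂ))
      (fun x => O.joint β βH p (O.perm.symm x))) = _ := reducedHot_unitaryDiagonal hV _
  have h2 : (O.toIncoherentOperation hV).HH = unitaryDiagonal 1 O.hotEnergy := rfl
  have h3 : gibbsState βH (unitaryDiagonal 1 O.hotEnergy) = _ :=
    gibbsState_unitaryDiagonal (one_mem _) βH O.hotEnergy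
  have h4 := meanEnergy_unitaryDiagonal (one_mem (Matrix.unitaryGroup O.Hot ℂ)) O.hotEnergy
  have e1 : ∑ x, O.joint β βH p x * O.hotEnergy x.2.2
      = ∑ b, O.hotEnergy b * boltzmann βH O.hotEnergy b := by
    have : ∀ x, O.joint β βH p x * O.hotEnergy x.2.2 = p x.1 * (boltzmann β O.coldEnergy x.2.1 *
        (O.hotEnergy x.2.2 * boltzmann βH O.hotEnergy x.2.2)) := fun x => by
      rw [joint]; ring
    simp only [this, Fintype.sum_prod_type, ← Finset.mul_sum, ← Finset.sum_mul, sum_boltzmann, hp,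
      one_mul]
  have e2 : ∑ x, O.joint β βH p x * O.hotEnergy (O.perm x).2.2
      = ∑ b, O.hotEnergy b * ∑ i, ∑ a, O.joint β βH p (O.perm.symm (i, a, b)) := by
    rw [← Equiv.sum_comp O.perm.symm]
    simp only [Equiv.apply_symm_apply, Fintype.sum_prod_type, Finset.mul_sum]
    simp_rw [Finset.sum_comm (s := (Finset.univ : Finset O.C)) (t := (Finset.univ : Finset O.Hot))]
    rw [Finset.sum_comm]
    exact Finset.sum_congr rfl fun b _ => Finset.sum_congr rfl fun i _ =>
      Finset.sum_congr rfl fun a _ => mul_comm _ _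
  simp only [classicalHeat, mul_sub, Finset.sum_sub_distrib, e1, e2]
  rw [← h4, ← h4, ← h3, ← h1]

theorem complexityLE_toIncoherentOperation (O : PermutationMachine ω)
    (hV : V ∈ Matrix.unitaryGroup s ℂ) {K : ℕ} (hC : Fintype.card O.C ≤ K)
    (hHot : Fintype.card O.Hot ≤ K)
    (hK : Fintype.card s * (Fintype.card O.C * Fintype.card O.Hot) ≤ K) :
    (O.toIncoherentOperation hV).ComplexityLE K := by
  refine ⟨hC, hHot, (effectiveDimension_le_card _).trans ?_⟩
  rw [Fintype.card_prod, Fintype.card_prod]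
  exact hK

theorem card_support_le_effectiveDimension (O : PermutationMachine ω)
    (hV : V ∈ Matrix.unitaryGroup s ℂ) :
    O.perm.support.card ≤ 2 * effectiveDimension (O.toIncoherentOperation hV).U :=
  card_support_le_two_mul_effectiveDimension (kronecker_one_mem_unitaryGroup hV) O.perm

theorem outDist_comp (O Q : PermutationMachine ω) (β βH : ℝ) (p : s → ℝ) :
    (O.comp Q).outDist β βH p = Q.outDist β βH (O.outDist β βH p) := by
  have key : ∀ f : s → ℝ, ∑ i, (O.comp Q).outDist β βH p i * f i
      = ∑ i, Q.outDist β βH (O.outDist β βH p) i * f i := fun f => by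
    rw [← sum_joint_mul, ← sum_joint_mul]
    exact (sum_joint_comp O Q β βH p (fun x a b => f (Q.perm ((O.perm x).1, a, b)).1)).trans
      (sum_joint_mul_sum O Q β βH p fun y => f (Q.perm y).1)
  ext j
  simpa [Pi.single_apply] using key (Pi.single j 1)

/-- The levels of cold and hot part in the presence of which the machine does nothing. -/
def idle (O : PermutationMachine ω) : Finset (O.C × O.Hot) :=
  {y | ∀ i, O.perm (i, y) = (i, y)}

/-- With the machine levels of `O` idle, the composite acts as `Q` alone. Hence each pair of an idle
level of `O` and a point moved by `Q` yields a point moved by the composite. -/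
theorem card_support_comp (O Q : PermutationMachine ω) :
    O.idle.card * Q.perm.support.card ≤ (O.comp Q).perm.support.card := by
  rw [← Finset.card_product]
  refine Finset.card_le_card_of_injOn
    (fun z => (z.2.1, (z.1.1, z.2.2.1), (z.1.2, z.2.2.2))) ?_ ?_
  · rintro ⟨⟨a, b⟩, i, a', b'⟩ hz
    rw [Finset.mem_coe, Finset.mem_product, Equiv.Perm.mem_support, idle, Finset.mem_filter] at hz
    rw [Finset.mem_coe, Equiv.Perm.mem_support]
    intro heq
    refine hz.2 ?_
    have h1 := hz.1.2 i
    simp only [comp, Equiv.coe_fn_mk, Prod.mk.injEq] at heq h1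
    rw [h1] at heq
    exact Prod.ext heq.1 (Prod.ext heq.2.1.2 heq.2.2.2)
  · rintro ⟨⟨a, b⟩, i, a', b'⟩ - ⟨⟨c, d⟩, j, c', d'⟩ - heq
    simp only [Prod.mk.injEq] at heq ⊢
    obtain ⟨h1, ⟨h2, h3⟩, h4, h5⟩ := heq
    exact ⟨⟨h2, h4⟩, h1, h3, h5⟩

end PermutationMachine

/-! ### Exchange of the target with a virtual qudit. -/

section Exchange

/-- The exchange of the target level with the level of the virtual qudit spanned by the equal
levels of cold and hot part. Of the four additional levels of the cold part, two are swapped and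
two are idle. -/
def exchangeLevels {s : Type*} {n : ℕ} (e : s ≃ Fin n) :
    s × (Fin n ⊕ Bool × Bool) × Fin n → s × (Fin n ⊕ Bool × Bool) × Fin n
  | (i, Sum.inl k, l) =>
    if k = l then (e.symm k, Sum.inl (e i), e i) else (i, Sum.inl k, l)
  | (i, Sum.inr a, l) => (i, Sum.inr (a.1, xor a.1 a.2), l)

theorem exchangeLevels_involutive {s : Type*} {n : ℕ} (e : s ≃ Fin n) :
    Function.Involutive (exchangeLevels e) := by
  rintro ⟨i, k | ⟨a, b⟩, l⟩
  · by_cases h : k = l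
    · subst h
      simp [exchangeLevels]
    · simp [exchangeLevels, h]
  · simp [exchangeLevels]

variable {s : Type*} [Fintype s]

/-- The machine that exchanges the target with a virtual qudit made of a `d`-level hot part with
energies `h` and of the `d` levels with energies `c` of the cold part, which has four more levels of
energy `E`. -/
abbrev exchangeMachine {ω : s → ℝ} [Nonempty s] (c h : s → ℝ) (E : ℝ)
    (hch : ∀ i, c i + h i = ω i) : PermutationMachine ω :=
  let e := Fintype.equivFin s
  { C := Fin (Fintype.card s) ⊕ Bool × Bool
    Hot := Fin (Fintype.card s)
    nonemptyHot := e.symm.nonempty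
    coldEnergy := Sum.elim (fun k => c (e.symm k)) (fun _ => E)
    hotEnergy := fun k => h (e.symm k)
    perm := (exchangeLevels_involutive e).toPerm
    energy_perm := by
      rintro ⟨i, k | a, l⟩
      · by_cases hkl : k = l
        · subst hkl
          have h1 := hch i
          have h2 := hch (e.symm k)
          simp only [Function.Involutive.coe_toPerm, exchangeLevels, if_true, Sum.elim_inl,
            Equiv.symm_apply_apply]
          linarith
        · simp [exchangeLevels, hkl]
      · simp [exchangeLevels] }

variable {ω : s → ℝ} [Nonempty s] {c h : s → ℝ} {E : ℝ} (hch : ∀ i, c i + h i = ω i)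

theorem exchangeMachine_perm_inl_self (i : s) (k : Fin (Fintype.card s)) :
    (exchangeMachine c h E hch).perm (i, Sum.inl k, k)
      = ((Fintype.equivFin s).symm k, Sum.inl (Fintype.equivFin s i), Fintype.equivFin s i) :=
  if_pos rfl

theorem exchangeMachine_perm_inl_of_ne (i : s) {k l : Fin (Fintype.card s)} (hkl : k ≠ l) :
    (exchangeMachine c h E hch).perm (i, Sum.inl k, l) = (i, Sum.inl k, l) :=
  if_neg hkl

theorem exchangeMachine_perm_inr (i : s) (a : Bool × Bool) (l : Fin (Fintype.card s)) :
    (exchangeMachine c h E hch).perm (i, Sum.inr a, l) = (i, Sum.inr (a.1, xor a.1 a.2), l) :=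
  rfl

theorem exchangeMachine_perm_symm :
    (exchangeMachine c h E hch).perm.symm = (exchangeMachine c h E hch).perm :=
  rfl

theorem two_le_card_idle_exchangeMachine [DecidableEq s] :
    2 ≤ (exchangeMachine c h E hch).idle.card := by
  obtain ⟨l⟩ := (exchangeMachine c h E hch).nonemptyHot
  refine Finset.one_lt_card.mpr ⟨(Sum.inr (false, false), l), ?_, (Sum.inr (false, true), l), ?_, ?_⟩
  · exact Finset.mem_filter.mpr ⟨Finset.mem_univ _, fun i => exchangeMachine_perm_inr hch i _ l⟩
  · exact Finset.mem_filter.mpr ⟨Finset.mem_univ _, fun i => exchangeMachine_perm_inr hch i _ l⟩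
  · simp

theorem two_le_card_support_exchangeMachine [DecidableEq s] :
    2 ≤ (exchangeMachine c h E hch).perm.support.card := by
  obtain ⟨l⟩ := (exchangeMachine c h E hch).nonemptyHot
  obtain ⟨i⟩ := ‹Nonempty s›
  refine Finset.one_lt_card.mpr
    ⟨(i, Sum.inr (true, false), l), ?_, (i, Sum.inr (true, true), l), ?_, ?_⟩
  all_goals simp [Equiv.Perm.mem_support, exchangeLevels]

variable {β βH m : ℝ} {p σ : s → ℝ}

/-- Here `m` is the weight of the virtual qudit. Level `i` gains `p k * (m * σ i)` from each `k` and
loses `p i * (m * σ k)` to it; both sums collapse by normalisation. -/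
theorem outDist_exchangeMachine
    (hσ : ∀ i, boltzmann β (exchangeMachine c h E hch).coldEnergy (Sum.inl (Fintype.equivFin s i)) *
      boltzmann βH (exchangeMachine c h E hch).hotEnergy (Fintype.equivFin s i) = m * σ i)
    (hp : ∑ i, p i = 1) (hσ1 : ∑ i, σ i = 1) (i : s) :
    (exchangeMachine c h E hch).outDist β βH p i = p i + m * (σ i - p i) := by
  have hbase : ∑ a, ∑ b, (exchangeMachine c h E hch).joint β βH p (i, a, b) = p i := by
    simp only [PermutationMachine.joint, ← Finset.mul_sum, sum_boltzmann, mul_one]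
  have hdiff : (exchangeMachine c h E hch).outDist β βH p i
      - ∑ a, ∑ b, (exchangeMachine c h E hch).joint β βH p (i, a, b)
      = ∑ k, (p ((Fintype.equivFin s).symm k) * (m * σ i)
          - p i * (m * σ ((Fintype.equivFin s).symm k))) := by
    rw [PermutationMachine.outDist, ← Finset.sum_sub_distrib, Fintype.sum_sum_type,
      exchangeMachine_perm_symm]
    have hr : ∀ a : Bool × Bool,
        ∑ b, (exchangeMachine c h E hch).joint β βH p
          ((exchangeMachine c h E hch).perm (i, Sum.inr a, b))
        - ∑ b, (exchangeMachine c h E hch).joint β βH p (i, Sum.inr a, b) = 0 := fun a => by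
      rw [sub_eq_zero]
      rfl
    rw [Finset.sum_eq_zero (s := (Finset.univ : Finset (Bool × Bool))) fun a _ => hr a, add_zero]
    refine Finset.sum_congr rfl fun k _ => ?_
    rw [← Finset.sum_sub_distrib, Finset.sum_eq_single k]
    · have h1 := hσ ((Fintype.equivFin s).symm k)
      rw [Equiv.apply_symm_apply] at h1
      rw [exchangeMachine_perm_inl_self, PermutationMachine.joint, PermutationMachine.joint,
        ← h1, ← hσ i]
    · intro l _ hl
      rw [exchangeMachine_perm_inl_of_ne hch i hl.symm, sub_self]
    · simp
  rw [hbase] at hdiff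
  rw [← sub_eq_iff_eq_add', hdiff, Equiv.sum_comp (Fintype.equivFin s).symm
    (fun j => p j * (m * σ i) - p i * (m * σ j)), Finset.sum_sub_distrib, ← Finset.sum_mul, hp,
    ← Finset.mul_sum, ← Finset.mul_sum, hσ1]
  ring

/-- A jump of the target from `i` to `k`, of probability `p i * (m * σ k)`, takes the hot part from
level `k` to level `i` and so draws `h k - h i`. -/
theorem classicalHeat_exchangeMachine
    (hσ : ∀ i, boltzmann β (exchangeMachine c h E hch).coldEnergy (Sum.inl (Fintype.equivFin s i)) *
      boltzmann βH (exchangeMachine c h E hch).hotEnergy (Fintype.equivFin s i) = m * σ i)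
    (hp : ∑ i, p i = 1) (hσ1 : ∑ i, σ i = 1) :
    (exchangeMachine c h E hch).classicalHeat β βH p = ∑ i, h i * (m * (σ i - p i)) := by
  have h1 : (exchangeMachine c h E hch).classicalHeat β βH p
      = ∑ i, ∑ k, p i * (m * σ ((Fintype.equivFin s).symm k)) *
          (h ((Fintype.equivFin s).symm k) - h i) := by
    rw [PermutationMachine.classicalHeat]
    simp only [Fintype.sum_prod_type (α₁ := s)]
    refine Finset.sum_congr rfl fun i _ => ?_
    rw [Fintype.sum_prod_type, Fintype.sum_sum_type]
    have hr : ∀ (a : Bool × Bool), ∑ b, (exchangeMachine c h E hch).joint β βH p (i, Sum.inr a, b) *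
        ((exchangeMachine c h E hch).hotEnergy b - (exchangeMachine c h E hch).hotEnergy
          ((exchangeMachine c h E hch).perm (i, Sum.inr a, b)).2.2) = 0 := fun a => by
      refine Finset.sum_eq_zero fun b _ => ?_
      rw [exchangeMachine_perm_inr, sub_self, mul_zero]
    rw [Finset.sum_eq_zero (s := (Finset.univ : Finset (Bool × Bool))) fun a _ => hr a, add_zero]
    refine Finset.sum_congr rfl fun k _ => ?_
    rw [Finset.sum_eq_single k]
    · have h1 := hσ ((Fintype.equivFin s).symm k)
      rw [Equiv.apply_symm_apply] at h1
      rw [PermutationMachine.joint, h1, exchangeMachine_perm_inl_self]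
      simp only [Equiv.symm_apply_apply]
    · intro l _ hl
      rw [exchangeMachine_perm_inl_of_ne hch i hl.symm, sub_self, mul_zero]
    · simp
  have h2 : ∀ i, ∑ k, p i * (m * σ ((Fintype.equivFin s).symm k)) *
      (h ((Fintype.equivFin s).symm k) - h i)
      = p i * m * ∑ j, σ j * h j - m * (p i * h i) := fun i => by
    rw [Equiv.sum_comp (Fintype.equivFin s).symm (fun j => p i * (m * σ j) * (h j - h i))]
    have : ∀ j, p i * (m * σ j) * (h j - h i) = p i * m * (σ j * h j) - p i * m * h i * σ j :=
      fun j => by ring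
    simp only [this, Finset.sum_sub_distrib, ← Finset.mul_sum, hσ1]
    ring
  rw [h1]
  simp only [h2, Finset.sum_sub_distrib, ← Finset.sum_mul, ← Finset.mul_sum, hp]
  have : ∀ i, h i * (m * (σ i - p i)) = m * (σ i * h i) - m * (p i * h i) := fun i => by ring
  simp only [this, Finset.sum_sub_distrib, ← Finset.mul_sum, one_mul]

/-- The energies of the hot part for which a virtual qudit on cold and hot part can have level
distribution `σ`. -/
def hotLevel (ω : s → ℝ) (β βH : ℝ) (σ : s → ℝ) (i : s) : ℝ :=
  (Real.log (σ i) + β * ω i) / (β - βH)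

/-- The product of the partition functions of cold and hot part for the energies `ω - hotLevel` and
`hotLevel`. -/
def partitionProduct (ω : s → ℝ) (β βH : ℝ) (σ : s → ℝ) : ℝ :=
  (∑ i, Real.exp (-β * (ω i - hotLevel ω β βH σ i))) *
    ∑ i, Real.exp (-βH * hotLevel ω β βH σ i)

/-- Since the exchange covers only the fraction 1/T of the way to σ, the virtual qudit is made to
overshoot `p'` by the factor `T`. The weight equals 1/T exactly when the full partition functions
multiply to `T`; `hT` leaves a positive share for the spare levels. -/
theorem exists_machine_outDist_eq [DecidableEq s] {p' : s → ℝ} {T : ℝ} (hH : 0 < βH) (hβ : βH < β)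
    (hp : ∑ i, p i = 1) (hp' : ∑ i, p' i = 1)
    (hpos : ∀ i, 0 < p i + T * (p' i - p i))
    (hT : partitionProduct ω β βH (fun i => p i + T * (p' i - p i)) < T) :
    ∃ O : PermutationMachine ω, Fintype.card O.C = Fintype.card s + 4 ∧
      Fintype.card O.Hot = Fintype.card s ∧ 2 ≤ O.idle.card ∧ 2 ≤ O.perm.support.card ∧
      O.outDist β βH p = p' ∧
      O.classicalHeat β βH p
        = ∑ i, hotLevel ω β βH (fun i => p i + T * (p' i - p i)) i * (p' i - p i) := by
  set σ : s → ℝ := fun i => p i + T * (p' i - p i) with hσdef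
  set h := hotLevel ω β βH σ with hh
  set Zc := ∑ i, Real.exp (-β * (ω i - h i)) with hZc
  set Zh := ∑ i, Real.exp (-βH * h i) with hZh
  have hβ0 : β ≠ 0 := (hH.trans hβ).ne'
  have hZhpos : 0 < Zh := Finset.sum_pos (fun _ _ => Real.exp_pos _) Finset.univ_nonempty
  have hZcpos : 0 < Zc := Finset.sum_pos (fun _ _ => Real.exp_pos _) Finset.univ_nonempty
  have hT' : Zc * Zh < T := hT
  have hTpos : 0 < T := (mul_pos hZcpos hZhpos).trans hT'
  have hD : 0 < T / Zh - Zc := by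
    rw [sub_pos, lt_div_iff₀ hZhpos]
    exact hT'
  -- Four spare levels of this energy raise the cold partition function from `Zc` to `T / Zh`.
  set E := -Real.log ((T / Zh - Zc) / 4) / β with hE
  have hch : ∀ i, (fun i => ω i - h i) i + h i = ω i := fun i => sub_add_cancel _ _
  set O := exchangeMachine (fun i => ω i - h i) h E hch with hO
  have hZ1 : ∑ a, Real.exp (-β * O.coldEnergy a) = T / Zh := by
    have hexp : Real.exp (-β * E) = (T / Zh - Zc) / 4 := by
      rw [hE, neg_mul, mul_div_cancel₀ _ hβ0, neg_neg, Real.exp_log (by positivity)]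
    rw [Fintype.sum_sum_type]
    have h1 : ∑ k, Real.exp (-β * O.coldEnergy (Sum.inl k)) = Zc :=
      Equiv.sum_comp (Fintype.equivFin s).symm (fun i => Real.exp (-β * (ω i - h i)))
    have h2 : ∑ a : Bool × Bool, Real.exp (-β * O.coldEnergy (Sum.inr a)) = T / Zh - Zc := by
      refine (Finset.sum_congr (g := fun _ : Bool × Bool => (T / Zh - Zc) / 4) rfl
        fun _ _ => hexp).trans ?_
      rw [Finset.sum_const, Finset.card_univ, Fintype.card_prod, Fintype.card_bool, nsmul_eq_mul]
      push_cast
      ring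
    rw [h1, h2]
    ring
  have hZ2 : ∑ b, Real.exp (-βH * O.hotEnergy b) = Zh :=
    Equiv.sum_comp (Fintype.equivFin s).symm (fun i => Real.exp (-βH * h i))
  have hσ1 : ∑ i, σ i = 1 := by
    simp only [hσdef, Finset.sum_add_distrib, ← Finset.mul_sum, Finset.sum_sub_distrib, hp, hp']
    ring
  have hweights : ∀ i, boltzmann β O.coldEnergy (Sum.inl (Fintype.equivFin s i)) *
      boltzmann βH O.hotEnergy (Fintype.equivFin s i) = T⁻¹ * σ i := fun i => by
    -- This identity dictates the form of `hotLevel`: the cold and hot Boltzmann exponents must add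
    -- up to log σ.
    have hlog : -β * (ω i - h i) + -βH * h i = Real.log (σ i) := by
      have : (β - βH) * h i = Real.log (σ i) + β * ω i :=
        mul_div_cancel₀ _ (sub_pos.mpr hβ).ne'
      linarith
    have hc : O.coldEnergy (Sum.inl (Fintype.equivFin s i)) = ω i - h i :=
      congrArg (fun j => ω j - h j) ((Fintype.equivFin s).symm_apply_apply i)
    have hhot : O.hotEnergy (Fintype.equivFin s i) = h i :=
      congrArg h ((Fintype.equivFin s).symm_apply_apply i)
    rw [boltzmann, boltzmann, hZ1, hZ2, div_mul_div_comm, div_mul_cancel₀ _ hZhpos.ne', hc, hhot,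
      ← Real.exp_add, hlog, Real.exp_log (hpos i)]
    ring
  have hstep : ∀ i, T⁻¹ * (σ i - p i) = p' i - p i := fun i => by
    rw [hσdef]
    field_simp
    ring
  refine ⟨O, ?_, ?_, two_le_card_idle_exchangeMachine hch,
    two_le_card_support_exchangeMachine hch, ?_, ?_⟩
  · simp [hO]
  · simp [hO]
  · ext i
    rw [outDist_exchangeMachine hch hweights hp hσ1, hstep]
    ring
  · rw [classicalHeat_exchangeMachine hch hweights hp hσ1]
    simp only [hstep]

end Exchange

/-! ### From single steps to protocols and to one composite machine. -/

section Sequences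

variable {s : Type*} [Fintype s] [DecidableEq s] {ω : s → ℝ} {V : Matrix s s ℂ}

/-- The induction peels off the first operation, whose two idle machine levels double the support of
the rest. It starts at one operation because a machine that does nothing has empty support and would
violate the bound 2^0. -/
theorem exists_protocol_and_machine (hV : V ∈ Matrix.unitaryGroup s ℂ) {β βH : ℝ} {K : ℕ}
    (N : ℕ) (p : ℕ → s → ℝ) (q : ℕ → ℝ) (hp : ∀ j, ∑ i, p j i = 1)
    (hO : ∀ j ≤ N, ∃ O : PermutationMachine ω, (O.toIncoherentOperation hV).ComplexityLE K ∧
      2 ≤ O.idle.card ∧ 2 ≤ O.perm.support.card ∧ O.outDist β βH (p j) = p (j + 1) ∧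
      O.classicalHeat β βH (p j) = q j) :
    ∃ P : List (IncoherentOperation (unitaryDiagonal V ω)), P.length = N + 1 ∧
      (∀ O ∈ P, O.ComplexityLE K) ∧
      protocolOutput β βH P (unitaryDiagonal V (p 0)) = unitaryDiagonal V (p (N + 1)) ∧
      protocolHeat β βH P (unitaryDiagonal V (p 0)) = ∑ j ∈ Finset.range (N + 1), q j ∧
      ∃ Q : PermutationMachine ω, 2 ^ (N + 1) ≤ Q.perm.support.card ∧
        Q.outDist β βH (p 0) = p (N + 1) ∧
        Q.classicalHeat β βH (p 0) = ∑ j ∈ Finset.range (N + 1), q j := by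
  induction N generalizing p q with
  | zero =>
    obtain ⟨O, hK, -, hsupp, hout, hheat⟩ := hO 0 le_rfl
    refine ⟨[O.toIncoherentOperation hV], rfl, by simpa using hK, ?_, ?_, O, by simpa using hsupp,
      hout, by simpa using hheat⟩
    · simp only [protocolOutput, O.output_toIncoherentOperation hV, hout, zero_add]
    · simp [protocolHeat, O.heat_toIncoherentOperation hV β βH (hp 0), hheat]
  | succ N ih =>
    obtain ⟨O, hK, hidle, -, hout, hheat⟩ := hO 0 (Nat.zero_le _)
    rw [zero_add] at hout
    obtain ⟨P, hlen, hPK, hPout, hPheat, Q, hQ, hQout, hQheat⟩ :=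
      ih (fun j => p (j + 1)) (fun j => q (j + 1)) (fun j => hp _)
        (fun j hj => hO (j + 1) (Nat.succ_le_succ hj))
    simp only [zero_add] at hPout hPheat hQout hQheat
    refine ⟨O.toIncoherentOperation hV :: P, by simp [hlen], ?_, ?_, ?_, O.comp Q, ?_, ?_, ?_⟩
    · intro R hR
      rcases List.mem_cons.mp hR with rfl | hR
      · exact hK
      · exact hPK R hR
    · rw [protocolOutput, O.output_toIncoherentOperation hV, hout, hPout]
    · rw [protocolHeat, O.output_toIncoherentOperation hV, hout, hPheat,
        O.heat_toIncoherentOperation hV β βH (hp 0), hheat, Finset.sum_range_succ' q, add_comm]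
    · refine le_trans ?_ (O.card_support_comp Q)
      rw [pow_succ']
      exact Nat.mul_le_mul hidle hQ
    · rw [O.outDist_comp Q, hout, hQout]
    · rw [O.classicalHeat_comp Q, hout, hQheat, hheat, Finset.sum_range_succ' q, add_comm]

end Sequences

/-! ### Compactness, the second-order heat estimate and the zero-temperature limit. -/

section Estimates

variable {s : Type*} [Fintype s]

theorem boltzmann_le_one (b : ℝ) (ω : s → ℝ) (i : s) : boltzmann b ω i ≤ 1 :=
  haveI : Nonempty s := ⟨i⟩
  (Finset.single_le_sum (fun j _ => (boltzmann_pos b ω j).le) (Finset.mem_univ i)).trans_eq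
    (sum_boltzmann b ω)

theorem contDiff_boltzmann (ω : s → ℝ) (i : s) :
    ContDiff ℝ 1 (fun b => boltzmann b ω i) := by
  unfold boltzmann
  refine ContDiff.div (by fun_prop) (by fun_prop) fun b => ?_
  exact (Finset.sum_pos (fun _ _ => Real.exp_pos _) ⟨i, Finset.mem_univ i⟩).ne'

theorem exists_lipschitz_boltzmann (ω : s → ℝ) (β₀ β₁ : ℝ) :
    ∃ L : ℝ, 0 ≤ L ∧ ∀ b ∈ Set.Icc β₀ β₁, ∀ b' ∈ Set.Icc β₀ β₁, ∀ i,
      |boltzmann b' ω i - boltzmann b ω i| ≤ L * |b' - b| := by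
  have h : ∀ i, ∃ K, LipschitzOnWith K (fun b => boltzmann b ω i) (Set.Icc β₀ β₁) := fun i =>
    (contDiff_boltzmann ω i).contDiffOn.exists_lipschitzOnWith one_ne_zero (convex_Icc _ _)
      isCompact_Icc
  choose K hK using h
  refine ⟨∑ i, (K i : ℝ), Finset.sum_nonneg fun i _ => (K i).2, fun b hb b' hb' i => ?_⟩
  refine ((hK i).dist_le_mul b' hb' b hb).trans ?_
  rw [Real.dist_eq]
  exact mul_le_mul_of_nonneg_right
    (Finset.single_le_sum (f := fun i => (K i : ℝ)) (fun j _ => (K j).2) (Finset.mem_univ i))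
    (abs_nonneg _)

/-- The product of all populations is continuous and positive on a compact interval, and it bounds
each population from below since the others are at most 1. The factor 2 leaves room for an overshoot
of size δ. -/
theorem exists_pos_le_boltzmann (ω : s → ℝ) (β₀ β₁ : ℝ) :
    ∃ δ : ℝ, 0 < δ ∧ δ ≤ 1 ∧ ∀ b ∈ Set.Icc β₀ β₁, ∀ i, 2 * δ ≤ boltzmann b ω i := by
  rcases (Set.Icc β₀ β₁).eq_empty_or_nonempty with he | hne
  · exact ⟨1, one_pos, le_rfl, fun b hb => by simp [he] at hb⟩
  have hcont : Continuous (fun b => ∏ i, boltzmann b ω i) :=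
    continuous_finsetProd _ fun i _ => (contDiff_boltzmann ω i).continuous
  obtain ⟨b₀, -, hmin⟩ := isCompact_Icc.exists_isMinOn hne hcont.continuousOn
  have hpos : 0 < ∏ i, boltzmann b₀ ω i := Finset.prod_pos fun i _ => boltzmann_pos _ _ _
  have hle : ∏ i, boltzmann b₀ ω i ≤ 1 :=
    Finset.prod_le_one (fun i _ => (boltzmann_pos _ _ _).le) fun i _ => boltzmann_le_one _ _ _
  refine ⟨(∏ i, boltzmann b₀ ω i) / 2, half_pos hpos, by linarith, fun b hb i => ?_⟩
  classical
  calc 2 * ((∏ i, boltzmann b₀ ω i) / 2) = ∏ i, boltzmann b₀ ω i := by ring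
    _ ≤ ∏ i, boltzmann b ω i := hmin hb
    _ = boltzmann b ω i * ∏ j ∈ Finset.univ.erase i, boltzmann b ω j :=
        (Finset.mul_prod_erase _ _ (Finset.mem_univ i)).symm
    _ ≤ boltzmann b ω i := mul_le_of_le_one_right (boltzmann_pos _ _ _).le
        (Finset.prod_le_one (fun i _ => (boltzmann_pos _ _ _).le) fun i _ => boltzmann_le_one _ _ _)

/-- Continuity on a compact box gives one `T` for all steps, independent of their number. -/
theorem exists_partitionProduct_lt (ω : s → ℝ) (β βH : ℝ) {δ : ℝ} (hδ : 0 < δ) :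
    ∃ T : ℝ, 1 ≤ T ∧ ∀ σ : s → ℝ, (∀ i, δ ≤ σ i ∧ σ i ≤ 2) → partitionProduct ω β βH σ < T := by
  have hcont : ContinuousOn (partitionProduct ω β βH)
      (Set.Icc (fun _ : s => δ) (fun _ : s => (2 : ℝ))) := by
    unfold partitionProduct hotLevel
    have hlog : ∀ i, ContinuousOn (fun σ : s → ℝ => Real.log (σ i))
        (Set.Icc (fun _ : s => δ) (fun _ : s => (2 : ℝ))) := fun i =>
      (continuous_apply i).continuousOn.log fun σ hσ => (hδ.trans_le (hσ.1 i)).ne'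
    fun_prop
  obtain ⟨T, hT⟩ := isCompact_Icc.bddAbove_image hcont
  refine ⟨max T 0 + 1, by linarith [le_max_right T 0], fun σ hσ => ?_⟩
  have := hT ⟨σ, ⟨fun i => (hσ i).1, fun i => (hσ i).2⟩, rfl⟩
  linarith [le_max_left T 0]

theorem abs_log_sub_log_le {a b δ : ℝ} (hδ : 0 < δ) (ha : δ ≤ a) (hb : δ ≤ b) :
    |Real.log a - Real.log b| ≤ |a - b| / δ := by
  have key : ∀ x y, δ ≤ x → δ ≤ y → Real.log x - Real.log y ≤ |x - y| / δ := fun x y hx hy => by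
    have hy0 := hδ.trans_le hy
    have hx0 := hδ.trans_le hx
    rw [← Real.log_div hx0.ne' hy0.ne']
    calc Real.log (x / y) ≤ x / y - 1 := Real.log_le_sub_one_of_pos (div_pos hx0 hy0)
      _ = (x - y) / y := by field_simp
      _ ≤ |x - y| / y := by gcongr; exact le_abs_self _
      _ ≤ |x - y| / δ := by gcongr
  rw [abs_le]
  have h := key b a hb ha
  rw [abs_sub_comm] at h
  exact ⟨by linarith, key a b ha hb⟩

/-- Let φ(t) = t log t. The left side is |φ'(z)(y - x) - (φ(y) - φ(x))| at the overshot point z. By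
convexity φ(y) - φ(x) lies between φ'(x)(y - x) and φ'(y)(y - x), and z is within T|y - x| of both x
and y, where log has Lipschitz constant 1/δ. -/
theorem abs_mul_log_sub_le {x y δ T : ℝ} (hδ : 0 < δ) (hT : 1 ≤ T) (hx : δ ≤ x) (hy : δ ≤ y)
    (hz : δ ≤ x + T * (y - x)) :
    |(y - x) * Real.log (x + T * (y - x)) + (y - x) + Real.negMulLog y - Real.negMulLog x|
      ≤ T * |y - x| ^ 2 / δ := by
  have hx0 := hδ.trans_le hx
  have hy0 := hδ.trans_le hy
  set z := x + T * (y - x) with hzdef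
  have h1 : x * (Real.log y - Real.log x) ≤ y - x := by
    rw [← Real.log_div hy0.ne' hx0.ne']
    calc x * Real.log (y / x) ≤ x * (y / x - 1) :=
          mul_le_mul_of_nonneg_left (Real.log_le_sub_one_of_pos (div_pos hy0 hx0)) hx0.le
      _ = y - x := by field_simp
  have h2 : y * (Real.log x - Real.log y) ≤ x - y := by
    rw [← Real.log_div hx0.ne' hy0.ne']
    calc y * Real.log (x / y) ≤ y * (x / y - 1) :=
          mul_le_mul_of_nonneg_left (Real.log_le_sub_one_of_pos (div_pos hx0 hy0)) hy0.le
      _ = x - y := by field_simp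
  have hb : ∀ w, δ ≤ w → |z - w| ≤ T * |y - x| →
      |(y - x) * (Real.log z - Real.log w)| ≤ T * |y - x| ^ 2 / δ := fun w hw hzw => by
    rw [abs_mul]
    calc |y - x| * |Real.log z - Real.log w| ≤ |y - x| * (T * |y - x| / δ) := by
          gcongr
          exact (abs_log_sub_log_le hδ hz hw).trans (by gcongr)
      _ = _ := by ring
  have hbx := hb x hx (by rw [hzdef, add_sub_cancel_left, abs_mul, abs_of_nonneg (by linarith)])
  have hby := hb y hy (by
    have : z - y = (T - 1) * (y - x) := by rw [hzdef]; ring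
    rw [this, abs_mul, abs_of_nonneg (by linarith)]
    exact mul_le_mul_of_nonneg_right (by linarith) (abs_nonneg _))
  rw [abs_le] at hbx hby ⊢
  simp only [Real.negMulLog]
  constructor
  · have e : (y - x) * Real.log z + (y - x) + -y * Real.log y - -x * Real.log x
        = (y - x) * (Real.log z - Real.log y) + ((y - x) - x * (Real.log y - Real.log x)) := by ring
    rw [e]; linarith
  · have e : (y - x) * Real.log z + (y - x) + -y * Real.log y - -x * Real.log x
        = (y - x) * (Real.log z - Real.log x) + (y * (Real.log x - Real.log y) - (x - y)) := by ring
    rw [e]; linarith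

/-- The free energy of a level distribution, in units of the temperature `1 / β`. -/
def reducedFreeEnergy (ω : s → ℝ) (β : ℝ) (p : s → ℝ) : ℝ :=
  ∑ i, (β * (ω i * p i) - Real.negMulLog (p i))

/-- The energy terms cancel exactly, being linear in the distribution; only the entropy contributes
an error, of second order in the step size `r`. -/
theorem abs_sum_hotLevel_sub_le {ω : s → ℝ} {β βH δ T r : ℝ} {p p' : s → ℝ} (hβ : βH < β)
    (hδ : 0 < δ) (hT : 1 ≤ T) (hp : ∑ i, p i = 1) (hp' : ∑ i, p' i = 1) (hpδ : ∀ i, δ ≤ p i)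
    (hpδ' : ∀ i, δ ≤ p' i) (hz : ∀ i, δ ≤ p i + T * (p' i - p i)) (hr : ∀ i, |p' i - p i| ≤ r) :
    |∑ i, hotLevel ω β βH (fun i => p i + T * (p' i - p i)) i * (p' i - p i)
        - (reducedFreeEnergy ω β p' - reducedFreeEnergy ω β p) / (β - βH)|
      ≤ Fintype.card s * (T * r ^ 2 / δ) / (β - βH) := by
  have hβ' : 0 < β - βH := sub_pos.mpr hβ
  -- Conservation of probability supplies the constant 1 in the derivative log t + 1 of t log t.
  have hzero : ∑ i, (p' i - p i) = 0 := by rw [Finset.sum_sub_distrib, hp, hp', sub_self]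
  have e : ∑ i, hotLevel ω β βH (fun i => p i + T * (p' i - p i)) i * (p' i - p i)
        - (reducedFreeEnergy ω β p' - reducedFreeEnergy ω β p) / (β - βH)
      = (∑ i, ((p' i - p i) * Real.log (p i + T * (p' i - p i)) + (p' i - p i)
          + Real.negMulLog (p' i) - Real.negMulLog (p i))) / (β - βH) := by
    have h1 : ∑ i, ((p' i - p i) * Real.log (p i + T * (p' i - p i)) + (p' i - p i)
          + Real.negMulLog (p' i) - Real.negMulLog (p i))
        = ∑ i, ((p' i - p i) * Real.log (p i + T * (p' i - p i))
          + Real.negMulLog (p' i) - Real.negMulLog (p i)) := by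
      rw [← sub_eq_zero, ← Finset.sum_sub_distrib, ← hzero]
      exact Finset.sum_congr rfl fun i _ => by ring
    rw [h1, reducedFreeEnergy, reducedFreeEnergy, ← Finset.sum_sub_distrib, Finset.sum_div,
      Finset.sum_div, ← Finset.sum_sub_distrib]
    refine Finset.sum_congr rfl fun i _ => ?_
    rw [hotLevel]
    ring
  rw [e, abs_div, abs_of_pos hβ']
  gcongr
  refine (Finset.abs_sum_le_sum_abs _ _).trans ?_
  refine (Finset.sum_le_sum (g := fun _ => T * r ^ 2 / δ) fun i _ => ?_).trans_eq ?_
  · refine (abs_mul_log_sub_le hδ hT (hpδ i) (hpδ' i) (hz i)).trans ?_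
    have := hr i
    gcongr
  · simp

open Filter Topology

theorem tendsto_boltzmann_minimizerDist (ω : s → ℝ) (i : s) :
    Tendsto (fun b => boltzmann b ω i) atTop (𝓝 (minimizerDist ω i)) := by
  classical
  have : Nonempty s := ⟨i⟩
  obtain ⟨i₀, hi₀⟩ := Finite.exists_min ω
  -- Measuring energies from their minimum gives every exponential a finite limit: 1 at minimisers,
  -- 0 elsewhere.
  have hb : ∀ b, boltzmann b ω i
      = Real.exp (-b * (ω i - ω i₀)) / ∑ j, Real.exp (-b * (ω j - ω i₀)) := fun b => by
    have h : ∀ j, Real.exp (-b * (ω j - ω i₀)) = Real.exp (-b * ω j) * Real.exp (b * ω i₀) :=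
      fun j => by rw [← Real.exp_add]; ring_nf
    simp only [h, ← Finset.sum_mul]
    rw [boltzmann, mul_div_mul_right _ _ (Real.exp_pos _).ne']
  have hlim : ∀ j, Tendsto (fun b : ℝ => Real.exp (-b * (ω j - ω i₀))) atTop
      (𝓝 (if ∀ k, ω j ≤ ω k then 1 else 0)) := fun j => by
    split_ifs with hj
    · have : ω j - ω i₀ = 0 := sub_eq_zero.mpr (le_antisymm (hj i₀) (hi₀ j))
      simp [this]
    · have hpos : 0 < ω j - ω i₀ := by
        push Not at hj
        obtain ⟨k, hk⟩ := hj
        linarith [hi₀ k]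
      refine Real.tendsto_exp_atBot.comp ?_
      exact (tendsto_neg_atTop_atBot).atBot_mul_const hpos
  simp only [hb]
  refine ((hlim i).div (tendsto_finsetSum _ fun j _ => hlim j) ?_)
  have h1 : ∀ j : s, (0 : ℝ) ≤ if ∀ k, ω j ≤ ω k then 1 else 0 := fun j => by
    split_ifs <;> norm_num
  refine (lt_of_lt_of_le one_pos ?_).ne'
  refine le_trans ?_ (Finset.single_le_sum (fun j _ => h1 j) (Finset.mem_univ i₀))
  rw [if_pos hi₀]

end Estimates

/-! ### Cooling protocols and their limits. -/

section Cooling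

variable {s : Type*} [Fintype s] [DecidableEq s]

theorem AchievableWithin.mono {HS : Matrix s s ℂ} {β βH : ℝ} {K : ℕ}
    {final final' : Matrix s s ℂ → Prop} {cost cost' : ℝ → Prop}
    (h : AchievableWithin HS β βH K final cost) (hfinal : ∀ ρ, final ρ → final' ρ)
    (hcost : ∀ q, cost q → cost' q) : AchievableWithin HS β βH K final' cost' := by
  obtain ⟨N₀, h⟩ := h
  refine ⟨N₀, fun N hN => ?_⟩
  obtain ⟨P, h1, h2, h3, h4, h5⟩ := h N hN
  exact ⟨P, h1, h2, hfinal _ h3, hcost _ h4, h5⟩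

theorem freeEnergy_eq_reducedFreeEnergy {V : Matrix s s ℂ} (hV : V ∈ Matrix.unitaryGroup s ℂ)
    {β : ℝ} (hβ : β ≠ 0) (ω p : s → ℝ) :
    freeEnergy β (unitaryDiagonal V ω) (unitaryDiagonal V p) = β⁻¹ * reducedFreeEnergy ω β p := by
  rw [freeEnergy_unitaryDiagonal hV, reducedFreeEnergy, Finset.sum_sub_distrib, mul_sub,
    ← Finset.mul_sum, inv_mul_cancel_left₀ hβ]

theorem inv_efficiency_mul_freeEnergy_sub {V : Matrix s s ℂ} (hV : V ∈ Matrix.unitaryGroup s ℂ)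
    {β βH : ℝ} (hH : 0 < βH) (hβ : βH < β) (ω p p' : s → ℝ) :
    (1 - βH / β)⁻¹ * (freeEnergy β (unitaryDiagonal V ω) (unitaryDiagonal V p')
        - freeEnergy β (unitaryDiagonal V ω) (unitaryDiagonal V p))
      = (reducedFreeEnergy ω β p' - reducedFreeEnergy ω β p) / (β - βH) := by
  have hβ0 : β ≠ 0 := (hH.trans hβ).ne'
  have hβ1 : β - βH ≠ 0 := (sub_pos.mpr hβ).ne'
  rw [freeEnergy_eq_reducedFreeEnergy hV hβ0, freeEnergy_eq_reducedFreeEnergy hV hβ0]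
  have : 1 - βH / β = (β - βH) / β := by field_simp
  rw [this]
  field_simp

/-- Discretized isothermal cooling along thermal states: the one with `n` equal steps of inverse
temperature is exact in its final state and has heat within `O(1/n)` of the Carnot-Landauer
value. -/
theorem exists_cooling_steps [Nonempty s] {V : Matrix s s ℂ} (hV : V ∈ Matrix.unitaryGroup s ℂ)
    (ω : s → ℝ) {β βH βstar : ℝ} (hH : 0 < βH) (hβ : βH < β) (hstar : β ≤ βstar) :
    ∃ A B : ℝ, ∀ N : ℕ, A < N + 1 → ∃ q : ℕ → ℝ,
      (∀ j ≤ N, ∃ O : PermutationMachine ω,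
        (O.toIncoherentOperation hV).ComplexityLE ((Fintype.card s + 4) ^ 3) ∧
        2 ≤ O.idle.card ∧ 2 ≤ O.perm.support.card ∧
        O.outDist β βH (boltzmann (β + j * ((βstar - β) / (N + 1))) ω)
          = boltzmann (β + (j + 1 : ℕ) * ((βstar - β) / (N + 1))) ω ∧
        O.classicalHeat β βH (boltzmann (β + j * ((βstar - β) / (N + 1))) ω) = q j) ∧
      |∑ j ∈ Finset.range (N + 1), q j
        - (reducedFreeEnergy ω β (boltzmann βstar ω) - reducedFreeEnergy ω β (boltzmann β ω))
          / (β - βH)| ≤ B / (N + 1) := by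
  obtain ⟨L, hL, hLip⟩ := exists_lipschitz_boltzmann ω β βstar
  obtain ⟨δ, hδ, hδ1, hlow⟩ := exists_pos_le_boltzmann ω β βstar
  obtain ⟨T, hT, hpart⟩ := exists_partitionProduct_lt ω β βH hδ
  set D := βstar - β with hD
  have hD0 : 0 ≤ D := sub_nonneg.mpr hstar
  -- The first constant makes `T * r ≤ δ` for the largest change `r` of a population per step; the
  -- second is (N + 1)² times the error bound for one step.
  refine ⟨T * L * D / δ, Fintype.card s * (T * (L * D) ^ 2 / δ) / (β - βH), fun N hN => ?_⟩
  have hN1 : (0 : ℝ) < N + 1 := by positivity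
  set p : ℕ → s → ℝ := fun j => boltzmann (β + j * (D / (N + 1))) ω with hp
  have hmem : ∀ j : ℕ, j ≤ N + 1 → β + j * (D / (N + 1)) ∈ Set.Icc β βstar := fun j hj => by
    have hj' : (j : ℝ) ≤ N + 1 := by exact_mod_cast hj
    have h1 : j * (D / (N + 1)) ≤ D := by
      calc j * (D / (N + 1)) ≤ (N + 1) * (D / (N + 1)) := by gcongr
        _ = D := mul_div_cancel₀ _ hN1.ne'
    exact ⟨le_add_of_nonneg_right (by positivity), by linarith⟩
  set r := L * (D / (N + 1)) with hr
  have hstep : ∀ j ≤ N, ∀ i, |p (j + 1) i - p j i| ≤ r := fun j hj i => by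
    refine (hLip _ (hmem j (by omega)) _ (hmem (j + 1) (by omega)) i).trans_eq ?_
    have : β + ((j + 1 : ℕ) : ℝ) * (D / (N + 1)) - (β + j * (D / (N + 1))) = D / (N + 1) := by
      push_cast; ring
    rw [this, abs_of_nonneg (by positivity)]
  have hTr : T * r ≤ δ := by
    rw [div_lt_iff₀ hδ] at hN
    have : T * r = T * L * D / (N + 1) := by rw [hr]; ring
    rw [this, div_le_iff₀ hN1]
    linarith
  have hpδ : ∀ j ≤ N + 1, ∀ i, 2 * δ ≤ p j i := fun j hj i => hlow _ (hmem j hj) i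
  have hsum : ∀ j, ∑ i, p j i = 1 := fun j => sum_boltzmann _ _
  -- The overshot distribution stays in the box on which `T` exceeds the partition product:
  -- populations lie between 2δ and 1, and the overshoot is at most δ ≤ 1.
  have hz : ∀ j ≤ N, ∀ i, δ ≤ p j i + T * (p (j + 1) i - p j i) ∧
      p j i + T * (p (j + 1) i - p j i) ≤ 2 := fun j hj i => by
    have h1 : |T * (p (j + 1) i - p j i)| ≤ δ := by
      rw [abs_mul, abs_of_nonneg (by linarith : (0 : ℝ) ≤ T)]
      exact (mul_le_mul_of_nonneg_left (hstep j hj i) (by linarith)).trans hTr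
    rw [abs_le] at h1
    have h2 := hpδ j (by omega) i
    have h3 : p j i ≤ 1 := boltzmann_le_one _ _ _
    constructor <;> linarith
  refine ⟨fun j => ∑ i, hotLevel ω β βH (fun i => p j i + T * (p (j + 1) i - p j i)) i *
    (p (j + 1) i - p j i), fun j hj => ?_, ?_⟩
  · obtain ⟨O, hC, hHot, hidle, hsupp, hout, hheat⟩ := exists_machine_outDist_eq (ω := ω) hH hβ
      (hsum j) (hsum (j + 1)) (fun i => hδ.trans_le (hz j hj i).1) (hpart _ (hz j hj))
    refine ⟨O, O.complexityLE_toIncoherentOperation hV ?_ ?_ ?_, hidle, hsupp, hout, hheat⟩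
    · rw [hC]
      exact Nat.le_self_pow (by norm_num) _
    · rw [hHot]
      exact le_trans (by omega) (Nat.le_self_pow (by norm_num) _)
    · rw [hC, hHot]
      calc Fintype.card s * ((Fintype.card s + 4) * Fintype.card s)
          ≤ (Fintype.card s + 4) * ((Fintype.card s + 4) * (Fintype.card s + 4)) := by
            gcongr <;> omega
        _ = _ := by ring
  · have hends : reducedFreeEnergy ω β (boltzmann βstar ω) - reducedFreeEnergy ω β (boltzmann β ω)
        = ∑ j ∈ Finset.range (N + 1),
          (reducedFreeEnergy ω β (p (j + 1)) - reducedFreeEnergy ω β (p j)) := by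
      rw [Finset.sum_range_sub (fun j => reducedFreeEnergy ω β (p j))]
      have h1 : β + ((N + 1 : ℕ) : ℝ) * (D / (N + 1)) = βstar := by
        push_cast
        rw [mul_div_cancel₀ _ hN1.ne', hD]
        ring
      simp only [hp, h1, Nat.cast_zero, zero_mul, add_zero]
    rw [hends, Finset.sum_div, ← Finset.sum_sub_distrib]
    refine (Finset.abs_sum_le_sum_abs _ _).trans ?_
    refine (Finset.sum_le_sum
      (g := fun _ => Fintype.card s * (T * r ^ 2 / δ) / (β - βH)) fun j hj => ?_).trans_eq ?_
    · have hj' : j ≤ N := Nat.lt_succ_iff.mp (Finset.mem_range.mp hj)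
      exact abs_sum_hotLevel_sub_le hβ hδ hT (hsum j) (hsum (j + 1))
        (fun i => by linarith [hpδ j (by omega) i])
        (fun i => by linarith [hpδ (j + 1) (by omega) i])
        (fun i => (hz j hj' i).1) (hstep j hj')
    · rw [Finset.sum_const, Finset.card_range, nsmul_eq_mul, hr]
      push_cast
      field_simp

/-- Cooling of a thermal target to the inverse temperature `βstar`, with an exact final state. -/
theorem achievableWithin_gibbsState [Nonempty s] {HS : Matrix s s ℂ} (hHS : HS.IsHermitian)
    {β βH βstar ε : ℝ} (hH : 0 < βH) (hβ : βH < β) (hstar : β ≤ βstar) (hε : 0 < ε) :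
    AchievableWithin HS β βH ((Fintype.card s + 4) ^ 3) (fun ρ => ρ = gibbsState βstar HS)
      (fun q => |q - (1 - βH / β)⁻¹ *
        (freeEnergy β HS (gibbsState βstar HS) - freeEnergy β HS (gibbsState β HS))| < ε) := by
  obtain ⟨V, hV, ω, rfl⟩ := isHermitian_exists_eq_unitaryDiagonal hHS
  obtain ⟨A, B, hAB⟩ := exists_cooling_steps hV ω hH hβ hstar
  obtain ⟨N₀, hN₀⟩ := exists_nat_gt (max A (B / ε))
  refine ⟨N₀ + 1, fun N' hN' => ?_⟩
  obtain ⟨N, rfl⟩ : ∃ N, N' = N + 1 := ⟨N' - 1, by omega⟩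
  have hlarge : max A (B / ε) < (N : ℝ) + 1 := by
    have : (N₀ : ℝ) ≤ N := by exact_mod_cast Nat.succ_le_succ_iff.mp hN'
    linarith
  obtain ⟨q, hO, hq⟩ := hAB N ((le_max_left _ _).trans_lt hlarge)
  have hqε : B / (N + 1 : ℝ) < ε := by
    have := (le_max_right A (B / ε)).trans_lt hlarge
    rw [div_lt_iff₀ hε] at this
    rw [div_lt_iff₀ (by positivity)]
    linarith
  obtain ⟨P, hlen, hPK, hPout, hPheat, Q, hQ, hQout, hQheat⟩ := exists_protocol_and_machine hV N
    (fun j => boltzmann (β + j * ((βstar - β) / (N + 1))) ω) q (fun j => sum_boltzmann _ _) hO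
  have hlast : β + ((N + 1 : ℕ) : ℝ) * ((βstar - β) / (N + 1)) = βstar := by
    push_cast
    rw [mul_div_cancel₀ _ (by positivity)]
    ring
  simp only [Nat.cast_zero, zero_mul, add_zero, hlast] at hPout hPheat hQout hQheat
  rw [gibbsState_unitaryDiagonal hV, gibbsState_unitaryDiagonal hV,
    inv_efficiency_mul_freeEnergy_sub hV hH hβ]
  refine ⟨P, hlen, hPK, hPout, ?_, Q.toIncoherentOperation hV, ?_, ?_, ?_⟩
  · rw [hPheat]
    exact hq.trans_lt hqε
  -- At least 2^(N+1) levels move, so the effective dimension is at least 2^N ≥ N + 1.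
  · have h1 := hQ.trans (Q.card_support_le_effectiveDimension hV)
    have h2 : N < 2 ^ N := Nat.lt_two_pow_self
    rw [pow_succ'] at h1
    omega
  · rw [Q.output_toIncoherentOperation hV, hQout, hPout]
  · rw [Q.heat_toIncoherentOperation hV β βH (sum_boltzmann β ω), hQheat, hPheat]

open Filter Topology

theorem tendsto_traceDistance_gibbsState_groundState {HS : Matrix s s ℂ} (hHS : HS.IsHermitian) :
    Tendsto (fun b => traceDistance (gibbsState b HS) (groundState HS)) atTop (𝓝 0) := by
  obtain ⟨V, hV, ω, rfl⟩ := isHermitian_exists_eq_unitaryDiagonal hHS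
  simp only [gibbsState_unitaryDiagonal hV, groundState_unitaryDiagonal hV,
    traceDistance_unitaryDiagonal hV]
  have h : ∀ i, Tendsto (fun b => |boltzmann b ω i - minimizerDist ω i|) atTop (𝓝 0) := fun i => by
    simpa using ((tendsto_boltzmann_minimizerDist ω i).sub_const (minimizerDist ω i)).abs
  simpa using (tendsto_finsetSum Finset.univ fun i _ => h i).div_const 2

theorem tendsto_freeEnergy_gibbsState_groundState {HS : Matrix s s ℂ} (hHS : HS.IsHermitian)
    (β : ℝ) :
    Tendsto (fun b => freeEnergy β HS (gibbsState b HS)) atTop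
      (𝓝 (freeEnergy β HS (groundState HS))) := by
  obtain ⟨V, hV, ω, rfl⟩ := isHermitian_exists_eq_unitaryDiagonal hHS
  simp only [gibbsState_unitaryDiagonal hV, groundState_unitaryDiagonal hV,
    freeEnergy_unitaryDiagonal hV]
  have h := tendsto_boltzmann_minimizerDist ω
  refine (tendsto_finsetSum _ fun i _ => (h i).const_mul _).sub
    ((tendsto_finsetSum _ fun i _ => ?_).const_mul _)
  exact (Real.continuous_negMulLog.tendsto _).comp (h i)

/-- Cooling of a thermal target arbitrarily close to its ground state. -/
theorem achievableWithin_groundState [Nonempty s] {HS : Matrix s s ℂ} (hHS : HS.IsHermitian)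
    {β βH ε₁ ε₂ : ℝ} (hH : 0 < βH) (hβ : βH < β) (hε₁ : 0 < ε₁) (hε₂ : 0 < ε₂) :
    AchievableWithin HS β βH ((Fintype.card s + 4) ^ 3)
      (fun ρ => traceDistance ρ (groundState HS) < ε₁)
      (fun q => |q - (1 - βH / β)⁻¹ *
        (freeEnergy β HS (groundState HS) - freeEnergy β HS (gibbsState β HS))| < ε₂) := by
  have hcost := ((tendsto_freeEnergy_gibbsState_groundState hHS β).sub_const
    (freeEnergy β HS (gibbsState β HS))).const_mul (1 - βH / β)⁻¹
  -- A finite inverse temperature `b` is fixed first, close enough to the limit in state and, up to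
  -- half the tolerance, in heat. The complexity bound does not involve `b`.
  obtain ⟨b, hb1, hb2, hb⟩ := (((tendsto_traceDistance_gibbsState_groundState hHS).eventually_lt_const
    hε₁).and ((Metric.tendsto_nhds.mp hcost (ε₂ / 2) (half_pos hε₂)).and
      (eventually_ge_atTop β))).exists
  refine (achievableWithin_gibbsState hHS hH hβ hb (half_pos hε₂)).mono ?_ ?_
  · rintro ρ rfl
    exact hb1
  · intro q hq
    rw [Real.dist_eq] at hb2
    have := abs_add_le (q - (1 - βH / β)⁻¹ *
        (freeEnergy β HS (gibbsState b HS) - freeEnergy β HS (gibbsState β HS)))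
      ((1 - βH / β)⁻¹ *
        (freeEnergy β HS (gibbsState b HS) - freeEnergy β HS (gibbsState β HS))
        - (1 - βH / β)⁻¹ *
        (freeEnergy β HS (groundState HS) - freeEnergy β HS (gibbsState β HS)))
    rw [sub_add_sub_cancel] at this
    linarith

end Cooling

end

theorem mainTheorem3 {s : Type*} [Fintype s] [DecidableEq s] [Nonempty s] :
    ∃ K : ℕ, ∀ (HS : Matrix s s ℂ), HS.IsHermitian →
      ∀ β βH : ℝ, 0 < βH → βH < β →
        (∀ βstar : ℝ, β ≤ βstar → ∀ ε₁ > 0, ∀ ε₂ > 0,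
          AchievableWithin HS β βH K
            (fun ρ => ∃ β' : ℝ, |β' - βstar| < ε₁ ∧ ρ = gibbsState β' HS)
            (fun q => |q - (1 - βH / β)⁻¹ *
              (freeEnergy β HS (gibbsState βstar HS) - freeEnergy β HS (gibbsState β HS))| < ε₂)) ∧
        (∀ ε₁ > 0, ∀ ε₂ > 0,
          AchievableWithin HS β βH K
            (fun ρ => traceDistance ρ (groundState HS) < ε₁)
            (fun q => |q - (1 - βH / β)⁻¹ *
              (freeEnergy β HS (groundState HS) - freeEnergy β HS (gibbsState β HS))| < ε₂)) := by
  -- For a d-level target the cold part has d + 4 levels and the hot part d, so all dimensions,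
  -- including the joint one, are at most (d + 4)³.
  refine ⟨(Fintype.card s + 4) ^ 3, fun HS hHS β βH hH hβ => ⟨?_, ?_⟩⟩
  · intro βstar hstar ε₁ hε₁ ε₂ hε₂
    refine (achievableWithin_gibbsState hHS hH hβ hstar hε₂).mono (fun ρ hρ => ?_) fun _ h => h
    -- The final temperature is hit exactly; the tolerance `ε₁` is only needed to be positive.
    exact ⟨βstar, by simpa using hε₁, hρ⟩
  · intro ε₁ hε₁ ε₂ hε₂
    exact achievableWithin_groundState hHS hH hβ hε₁ hε₂
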